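/- All graphs are finite and simple; $\overline{G}$ is the complement of $G$, and $G|X$ the subgraph induced on $X\subseteq V(G)$. For integers $a,b\ge 0$ let $M_{a,b}$ be the disjoint union of $a$ edges and $b$ isolated vertices ($2a+b$ vertices). A graph is *semi-matched* if it is isomorphic to some $M_{a,b}$, *matched* if it is isomorphic to some $M_{a,0}$, *semi-antimatched* if it is isomorphic to some $\overline{M_{a,b}}$, and *antimatched* if it is isomorphic to some $\overline{M_{a,0}}$. Disjoint sets $A,B\subseteq V(G)$ with $G|A$ semi-matched and $G|B$ semi-antimatched are *aligned* if (i) for all adjacent $u,v\in A$ and all $w\in B$, $w$ is adjacent to exactly one of $u,v$; and (ii) for all $u\in A$ and all distinct non-adjacent $x,y\in B$, $u$ is adjacent to exactly one of $x,y$. A graph $G$ is *double-split* if $V(G)$ can be partitioned into (possibly empty) sets $A,B$ such that $G|A$ is matched, $G|B$ is antimatched, and $A$ and $B$ are aligned. A graph is *doubled* if it is (isomorphic to) an induced subgraph of some double-split graph. Let $F_1,\dots,F_{23}$ be the following graphs; the vertices of a graph on $n$ vertices are $0,\dots,n-1$, and $ij$ denotes the edge joining $i$ and $j$: - $F_{1}$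 ($5$ vertices): $01, 04, 12, 23, 34$; - $F_{2}$ ($5$ vertices): $02, 03, 04, 12, 13, 14$; - $F_{3}$ ($6$ vertices): $01, 12, 14, 23, 34, 35$; - $F_{4}$ ($6$ vertices): $01, 03, 12, 23, 45$; - $F_{5}$ ($6$ vertices): $01, 12, 23, 25, 34, 45$; - $F_{6}$ ($6$ vertices): $01, 03, 04, 05, 12, 23, 45$; - $F_{7}$ ($6$ vertices): $12, 15, 34$; - $F_{8}$ ($6$ vertices): $05, 12, 15, 34$; - $F_{9}$ ($6$ vertices): $12, 15, 25, 34, 35$; - $F_{10}$ ($6$ vertices): $05, 12, 15, 25, 34, 35$; - $F_{11}$ ($6$ vertices): $12, 15, 25, 34, 35, 45$; - $F_{12}$ ($6$ vertices): $05, 12, 15, 25, 34, 35, 45$; - $F_{13}$ ($7$ vertices): $01, 06, 12, 23, 34, 45, 56$; - $F_{14}$ ($7$ vertices): $01, 12, 16, 23, 26, 34, 36, 45, 46$; - $F_{15}$ ($7$ vertices): $01, 06, 12, 16, 23, 26, 34, 36, 45, 46$; - $F_{16}$ ($7$ vertices): $01, 06, 12, 16, 23, 26, 34, 36, 45, 46,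 56$; - $F_{17}$ ($7$ vertices): $01, 05, 12, 23, 34, 45$; - $F_{18}$ ($7$ vertices): $02, 03, 04, 06, 13, 14, 15, 24, 25, 35$; - $F_{19}$ ($7$ vertices): $01, 05, 06, 12, 16, 23, 26, 34, 36, 45, 46, 56$; - $F_{20}$ ($7$ vertices): $01, 05, 12, 15, 16, 23, 25, 26, 34, 45$; - $F_{21}$ ($7$ vertices): $02, 03, 04, 06, 13, 14, 24, 35, 46$; - $F_{22}$ ($9$ vertices): $02, 03, 04, 06, 07, 13, 14, 17, 24, 25, 26, 27, 28, 36, 46, 47, 67$; - $F_{23}$ ($9$ vertices): $02, 03, 04, 06, 13, 14, 15, 18, 24, 25, 27, 35, 36, 48, 57, 67, 68, 78$. Let $\mathcal F$ consist of $F_1,\dots,F_{23}$ and the complements of $F_2,\dots,F_{22}$ (the graphs $F_1=C_5$ and $F_{23}$ are self-complementary). **Theorem.** 1. A graph is doubled if and only if it contains no member of $\mathcal F$ as an induced subgraph. 2. Consequently $\mathcal F$ is the list of minimal forbidden induced subgraphs for the class of doubled graphs: a graph $G$ is not doubled while all its proper induced subgraphs are doubled if and only if $G$ is isomorphic to a member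 of $\mathcal F$. 3. $\mathcal F$ consists of exactly 44 graphs, no two of which are isomorphic. -/

import Mathlib

/-!
Doubled graphs and the list of 44 graphs excluded from them.
-/

universe u

namespace DoubledGraphs

open SimpleGraph

/-- `M a b` is the disjoint union of `a` edges and `b` isolated vertices: the `i`-th edge joins
`inl (i, false)` and `inl (i, true)`. -/
def M (a b : ℕ) : SimpleGraph ((Fin a × Bool) ⊕ Fin b) where
  Adj x y := ∃ i s t, x = Sum.inl (i, s) ∧ y = Sum.inl (i, t) ∧ s ≠ t
  symm := ⟨fun _ _ ⟨i, s, t, hx, hy, h⟩ => ⟨i, t, s, hy, hx, h.symm⟩⟩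
  loopless := ⟨fun _ ⟨_, _, _, hx, hy, h⟩ => h (by simpa using hx.symm.trans hy)⟩

/-- Isomorphic to some `M a b`. -/
def IsSemiMatched {V : Type*} (G : SimpleGraph V) : Prop :=
  ∃ a b : ℕ, Nonempty (G ≃g M a b)

/-- Isomorphic to some `M a 0`. -/
def IsMatched {V : Type*} (G : SimpleGraph V) : Prop :=
  ∃ a : ℕ, Nonempty (G ≃g M a 0)

/-- Isomorphic to the complement of some `M a b`. -/
def IsSemiAntimatched {V : Type*} (G : SimpleGraph V) : Prop :=
  ∃ a b : ℕ, Nonempty (G ≃g (M a b)ᶜ)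

/-- Isomorphic to the complement of some `M a 0`. -/
def IsAntimatched {V : Type*} (G : SimpleGraph V) : Prop :=
  ∃ a : ℕ, Nonempty (G ≃g (M a 0)ᶜ)

/-- Disjoint sets `A` (inducing a semi-matched graph) and `B` (inducing a semi-antimatched graph)
are aligned: every vertex of `B` is adjacent to exactly one end of each edge in `A`, and every
vertex of `A` is adjacent to exactly one of any two distinct non-adjacent vertices of `B`. -/
structure Aligned {V : Type*} (G : SimpleGraph V) (A B : Set V) : Prop where
  disjoint : Disjoint A B
  semiMatched : IsSemiMatched (G.induce A)
  semiAntimatched : IsSemiAntimatched (G.induce B)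
  edge : ∀ u ∈ A, ∀ v ∈ A, G.Adj u v → ∀ w ∈ B, Xor (G.Adj w u) (G.Adj w v)
  nonedge : ∀ u ∈ A, ∀ x ∈ B, ∀ y ∈ B, x ≠ y → ¬ G.Adj x y → Xor (G.Adj u x) (G.Adj u y)

/-- The vertex set is partitioned into `A` and `B`, where `A` induces a matched graph,
`B` induces an antimatched graph, and `A` and `B` are aligned. -/
def IsDoubleSplit {V : Type*} (G : SimpleGraph V) : Prop :=
  ∃ A B : Set V, Disjoint A B ∧ A ∪ B = Set.univ ∧
    IsMatched (G.induce A) ∧ IsAntimatched (G.induce B) ∧ Aligned G A B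

/-- An induced subgraph of some (finite) double-split graph. -/
def IsDoubled {V : Type u} (G : SimpleGraph V) : Prop :=
  ∃ (W : Type u) (_ : Finite W) (H : SimpleGraph W), IsDoubleSplit H ∧ G ⊴ H

/-- A graph that is not doubled, although all of its proper induced subgraphs are. -/
def IsMinimalNonDoubled {V : Type u} (G : SimpleGraph V) : Prop :=
  ¬ IsDoubled G ∧ ∀ s : Set V, s ≠ Set.univ → IsDoubled (G.induce s)

/-- The graph on `{0, …, n - 1}` whose edges are the listed pairs. -/
def ofEdges {n : ℕ} (E : List (Fin n × Fin n)) : SimpleGraph (Fin n) :=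
  SimpleGraph.fromRel fun u v => (u, v) ∈ E

/-- C₅ -/
def F1 : SimpleGraph (Fin 5) :=
  ofEdges [(0, 1), (0, 4), (1, 2), (2, 3), (3, 4)]

/-- K₂,₃ -/
def F2 : SimpleGraph (Fin 5) :=
  ofEdges [(0, 2), (0, 3), (0, 4), (1, 2), (1, 3), (1, 4)]

/-- The watch: C₄ with pendant edges at two opposite vertices -/
def F3 : SimpleGraph (Fin 6) :=
  ofEdges [(0, 1), (1, 2), (1, 4), (2, 3), (3, 4), (3, 5)]

/-- The disjoint union of C₄ and an edge -/
def F4 : SimpleGraph (Fin 6) :=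
  ofEdges [(0, 1), (0, 3), (1, 2), (2, 3), (4, 5)]

/-- The flag: C₄ with a path of two edges attached to one vertex -/
def F5 : SimpleGraph (Fin 6) :=
  ofEdges [(0, 1), (1, 2), (2, 3), (2, 5), (3, 4), (4, 5)]

/-- The fish: C₄ and a triangle sharing one vertex -/
def F6 : SimpleGraph (Fin 6) :=
  ofEdges [(0, 1), (0, 3), (0, 4), (0, 5), (1, 2), (2, 3), (4, 5)]

/-- The disjoint union of a path with two edges, an edge and a vertex -/
def F7 : SimpleGraph (Fin 6) :=
  ofEdges [(1, 2), (1, 5), (3, 4)]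

/-- The disjoint union of a path with three edges and an edge -/
def F8 : SimpleGraph (Fin 6) :=
  ofEdges [(0, 5), (1, 2), (1, 5), (3, 4)]

/-- A triangle with a path of two edges attached to one vertex, plus an isolated vertex -/
def F9 : SimpleGraph (Fin 6) :=
  ofEdges [(1, 2), (1, 5), (2, 5), (3, 4), (3, 5)]

/-- A triangle with a path of two edges and a pendant edge attached to the same vertex -/
def F10 : SimpleGraph (Fin 6) :=
  ofEdges [(0, 5), (1, 2), (1, 5), (2, 5), (3, 4), (3, 5)]

/-- Two triangles sharing one vertex, plus an isolated vertex -/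
def F11 : SimpleGraph (Fin 6) :=
  ofEdges [(1, 2), (1, 5), (2, 5), (3, 4), (3, 5), (4, 5)]

/-- Two triangles sharing one vertex, with a pendant edge there -/
def F12 : SimpleGraph (Fin 6) :=
  ofEdges [(0, 5), (1, 2), (1, 5), (2, 5), (3, 4), (3, 5), (4, 5)]

/-- C₇ -/
def F13 : SimpleGraph (Fin 7) :=
  ofEdges [(0, 1), (0, 6), (1, 2), (2, 3), (3, 4), (4, 5), (5, 6)]

/-- A path 0-1-2-3-4-5 with a further vertex 6 adjacent to 1, 2, 3, 4 -/
def F14 : SimpleGraph (Fin 7) :=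
  ofEdges [(0, 1), (1, 2), (1, 6), (2, 3), (2, 6), (3, 4), (3, 6), (4, 5), (4, 6)]

/-- The same with 6 adjacent to 0, 1, 2, 3, 4 -/
def F15 : SimpleGraph (Fin 7) :=
  ofEdges [(0, 1), (0, 6), (1, 2), (1, 6), (2, 3), (2, 6), (3, 4), (3, 6), (4, 5), (4, 6)]

/-- The same with 6 adjacent to the whole path -/
def F16 : SimpleGraph (Fin 7) :=
  ofEdges [(0, 1), (0, 6), (1, 2), (1, 6), (2, 3), (2, 6), (3, 4), (3, 6), (4, 5), (4, 6), (5, 6)]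

/-- The disjoint union of C₆ and a vertex -/
def F17 : SimpleGraph (Fin 7) :=
  ofEdges [(0, 1), (0, 5), (1, 2), (2, 3), (3, 4), (4, 5)]

/-- The triangular prism with a pendant edge -/
def F18 : SimpleGraph (Fin 7) :=
  ofEdges [(0, 2), (0, 3), (0, 4), (0, 6), (1, 3), (1, 4), (1, 5), (2, 4), (2, 5), (3, 5)]

/-- The wheel W₆ -/
def F19 : SimpleGraph (Fin 7) :=
  ofEdges [(0, 1), (0, 5), (0, 6), (1, 2), (1, 6), (2, 3), (2, 6), (3, 4), (3, 6), (4, 5),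
    (4, 6), (5, 6)]

/-- A path 0-1-2-3-4 with further vertices 5, adjacent to 0, 1, 2, 4, and 6, adjacent to 1, 2 -/
def F20 : SimpleGraph (Fin 7) :=
  ofEdges [(0, 1), (0, 5), (1, 2), (1, 5), (1, 6), (2, 3), (2, 5), (2, 6), (3, 4), (4, 5)]

/-- The complement of: a path 0-1-2-3-4 with further vertices 5, adjacent to 0, 1, 2, 4, 6, and 6,
adjacent to 1, 2, 3, 5 -/
def F21 : SimpleGraph (Fin 7) :=
  ofEdges [(0, 2), (0, 3), (0, 4), (0, 6), (1, 3), (1, 4), (2, 4), (3, 5), (4, 6)]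

/-- The complement of: a path 0-1-2-3-4 with further vertices 5, adjacent to 0, 1, 3, 4, 6, 7, 8,
and 6, adjacent to 1, 5, 8, and 7, adjacent to 3, 5, 8, and 8, adjacent to 0, 1, 3, 4, 5, 6, 7 -/
def F22 : SimpleGraph (Fin 9) :=
  ofEdges [(0, 2), (0, 3), (0, 4), (0, 6), (0, 7), (1, 3), (1, 4), (1, 7), (2, 4), (2, 5),
    (2, 6), (2, 7), (2, 8), (3, 6), (4, 6), (4, 7), (6, 7)]

/-- The line graph of K₃,₃ -/
def F23 : SimpleGraph (Fin 9) :=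
  ofEdges [(0, 2), (0, 3), (0, 4), (0, 6), (1, 3), (1, 4), (1, 5), (1, 8), (2, 4), (2, 5),
    (2, 7), (3, 5), (3, 6), (4, 8), (5, 7), (6, 7), (6, 8), (7, 8)]

/-- A finite graph with its number of vertices. -/
abbrev FinGraph : Type := Σ n : ℕ, SimpleGraph (Fin n)

/-- The two self-complementary members of the family. -/
def selfComplementaryMembers : List FinGraph :=
  [⟨5, F1⟩, ⟨9, F23⟩]

/-- One member from each of the 21 pairs of non-isomorphic complementary members. -/
def pairedMembers : List FinGraph :=
  [⟨5, F2⟩, ⟨6, F3⟩, ⟨6, F4⟩, ⟨6, F5⟩, ⟨6, F6⟩, ⟨6, F7⟩, ⟨6, F8⟩, ⟨6, F9⟩, ⟨6, F10⟩, ⟨6, F11⟩,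
    ⟨6, F12⟩, ⟨7, F13⟩, ⟨7, F14⟩, ⟨7, F15⟩, ⟨7, F16⟩, ⟨7, F17⟩, ⟨7, F18⟩, ⟨7, F19⟩, ⟨7, F20⟩,
    ⟨7, F21⟩, ⟨9, F22⟩]

/-- The 44 forbidden graphs: `F1`, …, `F23` and their complements. -/
def family : List FinGraph :=
  selfComplementaryMembers ++ pairedMembers ++ pairedMembers.map fun F => ⟨F.1, F.2ᶜ⟩

end DoubledGraphs

namespace DoubledGraphs

/-! ### Codes of ordered graphs -/

noncomputable section Checker

/-- The first `k` binary digits of a number. -/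
def bits : ℕ → ℕ → List Bool
  | 0, _ => []
  | k + 1, n => Nat.beq (n % 2) 1 :: bits k (n / 2)

/-- The code whose rows are given by binary numbers. -/
def decode : List ℕ → List (List Bool)
  | [] => []
  | n :: ns => bits ns.length n :: decode ns

/-- The code of the complement. -/
def complCode (f : List (List Bool)) : List (List Bool) :=
  f.map (List.map not)

/-- The number with given binary digits. -/
def mask (p : List Bool) : ℕ :=
  List.rec 0 (fun b _ ih => Nat.add (cond b 1 0) (Nat.mul 2 ih)) p

/-- Insert binary digits in front of numbers. -/
def consMasks (p : List Bool) : List ℕ → List ℕ :=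
  List.rec (fun _ => [])
    (fun b _ ih Cs => List.rec [] (fun C Cs _ => Nat.add (cond b 1 0) (Nat.mul 2 C) :: ih Cs) Cs) p

/-- The rows of the adjacency matrix of a graph given by a code. -/
def rowMasks (f : List (List Bool)) : List ℕ :=
  List.rec [] (fun p _ ih => Nat.mul 2 (mask p) :: consMasks p ih) f

/-- Candidates for the next vertices of an embedding, after a vertex with row `r` in the graph and
row `n` in the complement has been chosen. -/
def refineMasks (r n : ℕ) (p : List Bool) : List ℕ → List ℕ :=
  List.rec (fun _ => [])
    (fun b _ ih Cs => List.rec [] (fun C Cs _ => Nat.land C (cond b r n) :: ih Cs) Cs) p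

/-- Whether `k` holds for one of the pairs of rows that belong to the digits of a number. -/
def anyMask (k : ℕ → ℕ → Bool) (rows : List (ℕ × ℕ)) : ℕ → Bool :=
  List.rec (fun _ => false)
    (fun r _ ih m => cond (Nat.beq (Nat.mod m 2) 1) (or (k r.1 r.2) (ih (Nat.div m 2)))
      (ih (Nat.div m 2))) rows

/-- Search for an embedding of the graph with code `f`, with given candidates for each vertex. -/
def search (rows : List (ℕ × ℕ)) (f : List (List Bool)) : List ℕ → Bool :=
  List.rec (fun _ => true)
    (fun p _ ih Cs =>
      List.rec false (fun C Cs _ => anyMask (fun r n => ih (refineMasks r n p Cs)) rows C) Cs) f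

/-- Search for an embedding of the graph with code `f` into the graph with code `g`. -/
def embeds (f g : List (List Bool)) : Bool :=
  search ((rowMasks g).zip (rowMasks (complCode g))) f (f.map fun _ => mask (g.map fun _ => true))

/-- Hint `2 k + 1` asserts that the graph with code `g` contains the `k`-th graph of the list `L`,
hint `2 k + 2` that its complement does. -/
def checkHint (L : List (List (List Bool))) (g : List (List Bool)) : ℕ → Bool
  | 0 => false
  | h + 1 =>
    match L[h / 2]? with
    | none => false
    | some f => embeds f (cond (Nat.beq (h % 2) 0) g (complCode g))

/-- Checks of several graphs; the hints are the digits in base 100. -/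
def checkHints (L : List (List (List Bool))) : List (List (List Bool)) → ℕ → Bool
  | [], _ => true
  | g :: gs, h => checkHint L g (h % 100) && checkHints L gs (h / 100)

/-- The admissible colours and adjacencies of three vertices `x, y, z`: the colour `true` means
that a vertex is in the semi-matched part. -/
def okTriple : (x y z xy xz yz : Bool) → Bool
  | true, true, true, xy, xz, yz => !((xy && xz) || (xy && yz) || (xz && yz))
  | false, false, false, xy, xz, yz => (xy && xz) || (xy && yz) || (xz && yz)
  | true, true, false, xy, xz, yz => !xy || xor xz yz
  | true, false, true, xy, xz, yz => !xz || xor xy yz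
  | false, true, true, xy, xz, yz => !yz || xor xy xz
  | true, false, false, xy, xz, yz => yz || xor xy xz
  | false, true, false, xy, xz, yz => xz || xor xy yz
  | false, false, true, xy, xz, yz => xy || xor xz yz

/-- All triples consisting of one vertex of a list and two further vertices are admissible. -/
def okPair (b b' e : Bool) (c : List Bool) : (p q : List Bool) → Bool :=
  List.rec (fun _ _ => true)
    (fun c _ ih p q => List.rec true (fun p ps _ =>
      List.rec true (fun q qs _ => and (okTriple c b b' p q e) (ih ps qs)) q) p) c

/-- All triples consisting of two vertices of the list and one further vertex are admissible. -/
def okVertex (b : Bool) : (c : List Bool) → (f : List (List Bool)) → (p : List Bool) → Bool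
  | c :: cs, r :: f, p :: ps => okPair c b p cs r ps && okVertex b cs f ps
  | _, _, _ => true

/-- All triples are admissible. -/
def okColoring : (c : List Bool) → (f : List (List Bool)) → Bool
  | c :: cs, r :: f => okVertex c cs f r && okColoring cs f
  | _, _ => true

/-- All lists of truth values of a given length. -/
def patterns : ℕ → List (List Bool)
  | 0 => [[]]
  | n + 1 => (patterns n).flatMap fun p => [true :: p, false :: p]

/-- The patterns with hint `0`. -/
def zeroHints : List (List Bool) → ℕ → List (List Bool)
  | [], _ => []
  | p :: ps, h =>
    cond (Nat.beq (h % 100) 0) (p :: zeroHints ps (h / 100)) (zeroHints ps (h / 100))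

/-- The patterns with non-zero hint are those of vertices that produce a graph of the list. -/
def checkPatterns (L : List (List (List Bool))) (f : List (List Bool)) :
    List (List Bool) → ℕ → Bool
  | [], _ => true
  | p :: ps, h => (Nat.beq (h % 100) 0 || checkHint L (p :: f) (h % 100)) &&
      checkPatterns L f ps (h / 100)

/-- The members of a list together with the sublists that start there. -/
def heads {α : Type*} : List α → List (α × List α)
  | [] => []
  | a :: l => (a, a :: l) :: heads l

/-- Whether vertices of two types, with a given adjacency, are in no conflict. -/
def okTypes (c : List Bool) (t s : Bool × List Bool) (e : Bool) : Bool :=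
  Prod.rec (fun b p => Prod.rec (fun b' q => okPair b b' e c p q) s) t

/-- The adjacencies for which vertices of two types are in no conflict. -/
def okEdges (c : List Bool) (t s : Bool × List Bool) : List Bool :=
  cond (okTypes c t s true) (cond (okTypes c t s false) [true, false] [true])
    (cond (okTypes c t s false) [false] [])

/-- The graphs obtained by adding two vertices that are in conflict. -/
def conflictPairs (c : List Bool) (f : List (List Bool)) (T : List (Bool × List Bool)) :
    List (List (List Bool)) :=
  (heads T).flatMap fun t => t.2.flatMap fun s => [true, false].flatMap fun e =>
    cond (okTypes c t.1 s e) [] [(e :: s.2) :: t.1.2 :: f]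

/-- The graphs obtained by adding three vertices that are in conflict, although no two are. -/
def conflictTriples (c : List Bool) (f : List (List Bool)) (T : List (Bool × List Bool)) :
    List (List (List Bool)) :=
  (heads T).flatMap fun t => (heads t.2).flatMap fun s => (okEdges c t.1 s.1).flatMap fun e =>
    s.2.flatMap fun w => (okEdges c t.1 w).flatMap fun e' => [true, false].flatMap fun e'' =>
      cond (okTriple t.1.1 s.1.1 w.1 e e' e'') []
        (cond (okTypes c s.1 w e'') [(e'' :: e' :: w.2) :: (e :: s.1.2) :: t.1.2 :: f] [])

/-- A graph and one of its colourings, with hints that show that the colouring extends to all graphs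
that contain this graph but none of a list. -/
structure Seed where
  /-- The rows of the code of the graph. -/
  rows : List ℕ
  /-- The colouring. -/
  color : ℕ
  /-- Hints for single vertices. -/
  vertexHints : ℕ
  /-- Hints for pairs of vertices in conflict. -/
  pairHints : ℕ
  /-- Hints for triples of vertices in conflict. -/
  tripleHints : ℕ

/-- The code of the graph. -/
def Seed.graph (s : Seed) : List (List Bool) := decode s.rows

/-- The list of colours. -/
def Seed.colors (s : Seed) : List Bool := bits s.rows.length s.color

/-- The types of further vertices, with their colours. -/
def Seed.types (s : Seed) : List (Bool × List Bool) :=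
  (zeroHints (patterns s.rows.length) s.vertexHints).map fun p =>
    (okVertex true s.colors s.graph p, p)

/-- The verification of the hints. -/
def Seed.check (L : List (List (List Bool))) (s : Seed) : Bool :=
  okColoring s.colors s.graph &&
  (checkPatterns L s.graph (patterns s.rows.length) s.vertexHints &&
  ((s.types.all fun t => okVertex t.1 s.colors s.graph t.2) &&
  (checkHints L (conflictPairs s.colors s.graph s.types) s.pairHints &&
  checkHints L (conflictTriples s.colors s.graph s.types) s.tripleHints)))

/-- The verification of a list of seeds, each with respect to the preceding ones. -/
def checkSeeds (L : List (List (List Bool))) : List Seed → Bool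
  | [] => true
  | s :: ss => s.check L && checkSeeds (L ++ [s.graph]) ss

end Checker

open SimpleGraph

section Code

variable {V : Type*}

/-- The code of a list of vertices: the adjacencies of each vertex to the later ones. -/
def code (adj : V → V → Bool) : List V → List (List Bool)
  | [] => []
  | v :: vs => vs.map (adj v) :: code adj vs

/-- The adjacency of a graph as a function with values in `Bool`. -/
noncomputable def adjB (G : SimpleGraph V) (u v : V) : Bool :=
  open Classical in decide (G.Adj u v)

/-- The graph with a given code is an induced subgraph. -/
def Contains (G : SimpleGraph V) (f : List (List Bool)) : Prop :=
  ∃ ws : List V, ws.Nodup ∧ code (adjB G) ws = f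

/-- Neither the graph nor its complement contains a graph of the list. -/
def Free (L : List (List (List Bool))) (G : SimpleGraph V) : Prop :=
  ∀ f ∈ L, ¬ Contains G f ∧ ¬ Contains Gᶜ f

/-- The rows of a code have the right lengths. -/
def IsCode : List (List Bool) → Prop
  | [] => True
  | p :: f => p.length = f.length ∧ IsCode f

@[simp] theorem adjB_eq_true {G : SimpleGraph V} {u v : V} : adjB G u v = true ↔ G.Adj u v := by
  simp [adjB]

@[simp] theorem adjB_eq_false {G : SimpleGraph V} {u v : V} :
    adjB G u v = false ↔ ¬ G.Adj u v := by
  simp [adjB]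

theorem adjB_comm (G : SimpleGraph V) (u v : V) : adjB G u v = adjB G v u := by
  simp [adjB, G.adj_comm]

@[simp] theorem adjB_self (G : SimpleGraph V) (u : V) : adjB G u u = false := by
  simp [adjB]

theorem adjB_compl (G : SimpleGraph V) {u v : V} (h : u ≠ v) : adjB Gᶜ u v = !adjB G u v := by
  rw [Bool.eq_iff_iff]
  simp [h]

@[simp] theorem length_code (adj : V → V → Bool) (vs : List V) :
    (code adj vs).length = vs.length := by
  induction vs with
  | nil => rfl
  | cons v vs ih => simp [code, ih]

@[simp] theorem length_bits (k n : ℕ) : (bits k n).length = k := by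
  induction k generalizing n with
  | zero => rfl
  | succ k ih => simp [bits, ih]

@[simp] theorem length_decode (ns : List ℕ) : (decode ns).length = ns.length := by
  induction ns with
  | nil => rfl
  | cons n ns ih => simp [decode, ih]

theorem isCode_decode (ns : List ℕ) : IsCode (decode ns) := by
  induction ns with
  | nil => trivial
  | cons n ns ih => exact ⟨by simp, ih⟩

theorem code_map {W : Type*} (adj : V → V → Bool) (φ : W → V) (ws : List W) :
    code adj (ws.map φ) = code (fun x y => adj (φ x) (φ y)) ws := by
  induction ws with
  | nil => rfl
  | cons w ws ih => simp [code, ih, Function.comp_def]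

theorem complCode_code (G : SimpleGraph V) {vs : List V} (h : vs.Nodup) :
    complCode (code (adjB G) vs) = code (adjB Gᶜ) vs := by
  induction vs with
  | nil => rfl
  | cons v vs ih =>
    rw [List.nodup_cons] at h
    have h' : complCode (code (adjB G) (v :: vs)) =
      (vs.map (adjB G v)).map not :: complCode (code (adjB G) vs) := rfl
    rw [h', ih h.2, code, List.map_map]
    congr 1
    refine List.map_congr_left fun w hw => ?_
    rw [adjB_compl G (by rintro rfl; exact h.1 hw)]
    rfl

end Code

section Search

variable {V : Type*}

@[simp] theorem mask_cons (b : Bool) (p : List Bool) :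
    mask (b :: p) = (cond b 1 0) + 2 * mask p := rfl

theorem bit_land (b b' : Bool) (m n : ℕ) :
    ((cond b 1 0) + 2 * m) &&& ((cond b' 1 0) + 2 * n) = (cond (b && b') 1 0) + 2 * (m &&& n) := by
  have h : ∀ (b : Bool) (m : ℕ), (cond b 1 0) + 2 * m = Nat.bit b m := by
    rintro (_ | _) m <;> simp [Nat.bit, add_comm]
  rw [h, h, h, Nat.land_bit]

theorem mask_land (χ ψ : V → Bool) (vs : List V) :
    Nat.land (mask (vs.map χ)) (mask (vs.map ψ)) = mask (vs.map fun v => χ v && ψ v) := by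
  change mask (vs.map χ) &&& mask (vs.map ψ) = _
  induction vs with
  | nil => exact Nat.zero_and 0
  | cons v vs ih => rw [List.map_cons, List.map_cons, List.map_cons, mask_cons, mask_cons,
      mask_cons, bit_land, ih]

theorem consMasks_map (a : V → Bool) (m : V → ℕ) (vs : List V) :
    consMasks (vs.map a) (vs.map m) = vs.map fun x => (cond (a x) 1 0) + 2 * m x := by
  induction vs with
  | nil => rfl
  | cons v vs ih =>
    rw [List.map_cons, List.map_cons, List.map_cons, ← ih]
    rfl

theorem rowMasks_code (G : SimpleGraph V) (vs : List V) :
    rowMasks (code (adjB G) vs) = vs.map fun x => mask (vs.map (adjB G x)) := by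
  induction vs with
  | nil => rfl
  | cons v vs ih =>
    have h : rowMasks (code (adjB G) (v :: vs)) =
      (2 * mask (vs.map (adjB G v))) :: consMasks (vs.map (adjB G v)) (rowMasks (code (adjB G) vs)) :=
      rfl
    rw [h, ih, consMasks_map]
    simp [adjB_comm G v]

theorem refineMasks_map (r n : V → Bool) (p : List Bool) (χs : List (V → Bool)) (vs : List V) :
    refineMasks (mask (vs.map r)) (mask (vs.map n)) p (χs.map fun χ => mask (vs.map χ)) =
      (List.zipWith (fun b χ v => χ v && cond b (r v) (n v)) p χs).map
        fun χ => mask (vs.map χ) := by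
  induction p generalizing χs with
  | nil => rfl
  | cons b p ih =>
    cases χs with
    | nil => rfl
    | cons χ χs =>
      rw [List.map_cons, List.zipWith_cons_cons, List.map_cons, ← ih, ← mask_land]
      cases b <;> rfl

theorem exists_of_anyMask {k : ℕ → ℕ → Bool} {r n : V → ℕ} {χ : V → Bool} {vs : List V}
    (h : anyMask k (vs.map fun v => (r v, n v)) (mask (vs.map χ)) = true) :
    ∃ v, χ v = true ∧ k (r v) (n v) = true := by
  induction vs with
  | nil => cases h
  | cons v vs ih =>
    have h1 : ∀ b : Bool, ((cond b 1 0) + 2 * mask (vs.map χ)) % 2 = cond b 1 0 := by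
      rintro (_ | _) <;> simp
    have h2 : ∀ b : Bool, ((cond b 1 0) + 2 * mask (vs.map χ)) / 2 = mask (vs.map χ) := by
      rintro (_ | _)
      · simp
      · simp only [cond_true]; omega
    have h3 : anyMask k ((v :: vs).map fun v => (r v, n v)) (mask ((v :: vs).map χ)) =
      cond (Nat.beq (((cond (χ v) 1 0) + 2 * mask (vs.map χ)) % 2) 1)
        (or (k (r v) (n v)) (anyMask k (vs.map fun v => (r v, n v))
          (((cond (χ v) 1 0) + 2 * mask (vs.map χ)) / 2)))
        (anyMask k (vs.map fun v => (r v, n v))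
          (((cond (χ v) 1 0) + 2 * mask (vs.map χ)) / 2)) := rfl
    rw [h3, h1, h2] at h
    cases hv : χ v with
    | false => rw [hv] at h; exact ih h
    | true =>
      rw [hv] at h
      have h' : (k (r v) (n v) || anyMask k (vs.map fun v => (r v, n v)) (mask (vs.map χ))) = true :=
        h
      rw [Bool.or_eq_true] at h'
      exact h'.elim (fun h => ⟨v, hv, h⟩) ih

theorem exists_of_search (G : SimpleGraph V) (vs : List V) {f : List (List Bool)} (hf : IsCode f)
    (χs : List (V → Bool)) (hl : χs.length = f.length)
    (h : search (vs.map fun x => (mask (vs.map (adjB G x)), mask (vs.map (adjB Gᶜ x)))) f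
      (χs.map fun χ => mask (vs.map χ)) = true) :
    ∃ ws : List V, ws.Nodup ∧ code (adjB G) ws = f ∧
      List.Forall₂ (fun χ w => χ w = true) χs ws := by
  induction f generalizing χs with
  | nil =>
    obtain rfl := List.length_eq_zero_iff.1 hl
    exact ⟨[], List.nodup_nil, rfl, .nil⟩
  | cons p f ih =>
    cases χs with
    | nil => cases hl
    | cons χ χs =>
      obtain ⟨x, hx, h⟩ := exists_of_anyMask (r := fun x => mask (vs.map (adjB G x)))
        (n := fun x => mask (vs.map (adjB Gᶜ x)))
        (k := fun r n => search (vs.map fun x =>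
          (mask (vs.map (adjB G x)), mask (vs.map (adjB Gᶜ x)))) f
            (refineMasks r n p (χs.map fun χ => mask (vs.map χ)))) h
      rw [refineMasks_map] at h
      have hl' : χs.length = f.length := by simpa using hl
      obtain ⟨ws, hn, hc, hw⟩ := ih hf.2 _ (by simp [hf.1, hl']) h
      have hp : p.length = χs.length := by rw [hf.1, hl']
      have key : ∀ (p : List Bool) (χs : List (V → Bool)) (ws : List V), p.length = χs.length →
          List.Forall₂ (fun χ w => χ w = true)
            (List.zipWith (fun b χ v => χ v && cond b (adjB G x v) (adjB Gᶜ x v)) p χs) ws →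
          x ∉ ws ∧ ws.map (adjB G x) = p ∧ List.Forall₂ (fun χ w => χ w = true) χs ws := by
        intro p
        induction p with
        | nil =>
          intro χs ws hp h
          obtain rfl := List.length_eq_zero_iff.1 hp.symm
          cases h
          exact ⟨by simp, rfl, .nil⟩
        | cons b p ihp =>
          intro χs ws hp h
          cases χs with
          | nil => cases hp
          | cons χ χs =>
            rw [List.zipWith_cons_cons] at h
            cases h with
            | cons h1 h2 =>
              rename_i w ws
              obtain ⟨i1, i2, i3⟩ := ihp χs ws (by simpa using hp) h2
              rw [Bool.and_eq_true] at h1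
              have hxw : x ≠ w ∧ adjB G x w = b := by
                cases b with
                | true => exact ⟨(adjB_eq_true.1 h1.2).ne, h1.2⟩
                | false =>
                  have := adjB_eq_true.1 h1.2
                  rw [SimpleGraph.compl_adj] at this
                  exact ⟨this.1, adjB_eq_false.2 this.2⟩
              exact ⟨by simp [hxw.1, i1], by simp [hxw.2, i2], .cons h1.1 i3⟩
      obtain ⟨k1, k2, k3⟩ := key p χs ws hp hw
      exact ⟨x :: ws, List.nodup_cons.2 ⟨k1, hn⟩, by rw [code, k2, hc], .cons hx k3⟩

theorem contains_of_embeds (G : SimpleGraph V) {vs : List V} (hvs : vs.Nodup)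
    {f : List (List Bool)} (hf : IsCode f) (h : embeds f (code (adjB G) vs) = true) :
    Contains G f := by
  have h1 : f.map (fun _ => mask ((code (adjB G) vs).map fun _ => true)) =
      (f.map fun _ => (fun _ : V => true)).map fun χ => mask (vs.map χ) := by
    simp
  rw [embeds, complCode_code G hvs, rowMasks_code, rowMasks_code, h1, List.zip_map'] at h
  obtain ⟨ws, hn, hc, -⟩ := exists_of_search G vs hf _ (by simp) h
  exact ⟨ws, hn, hc⟩

theorem not_checkHint {L : List (List (List Bool))} (hL : ∀ f ∈ L, IsCode f) {G : SimpleGraph V}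
    (hG : Free L G) {vs : List V} (hvs : vs.Nodup) (h : ℕ) :
    checkHint L (code (adjB G) vs) h = false := by
  rw [← Bool.not_eq_true]
  intro hh
  cases h with
  | zero => cases hh
  | succ h =>
    rw [checkHint] at hh
    split at hh
    · cases hh
    · rename_i f hf
      have hf := List.mem_of_getElem? hf
      cases hb : Nat.beq (h % 2) 0 with
      | true =>
        rw [hb] at hh
        exact (hG f hf).1 (contains_of_embeds G hvs (hL f hf) hh)
      | false =>
        rw [hb, cond_false, complCode_code G hvs] at hh
        exact (hG f hf).2 (contains_of_embeds Gᶜ hvs (hL f hf) hh)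

theorem not_mem_of_checkHints {L : List (List (List Bool))} (hL : ∀ f ∈ L, IsCode f)
    {G : SimpleGraph V} (hG : Free L G) {gs : List (List (List Bool))} {h : ℕ}
    (hc : checkHints L gs h = true) {vs : List V} (hvs : vs.Nodup) :
    code (adjB G) vs ∉ gs := by
  induction gs generalizing h with
  | nil => simp
  | cons g gs ih =>
    rw [checkHints, Bool.and_eq_true] at hc
    rw [List.mem_cons, not_or]
    refine ⟨?_, ih hc.2⟩
    rintro rfl
    rw [not_checkHint hL hG hvs] at hc
    exact Bool.false_ne_true hc.1

theorem mem_zeroHints_of_checkPatterns {L : List (List (List Bool))} (hL : ∀ f ∈ L, IsCode f)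
    {G : SimpleGraph V} (hG : Free L G) {ps : List (List Bool)} {h : ℕ} {vs : List V} {v : V}
    (hvs : (v :: vs).Nodup)
    (hc : checkPatterns L (code (adjB G) vs) ps h = true) (hp : vs.map (adjB G v) ∈ ps) :
    vs.map (adjB G v) ∈ zeroHints ps h := by
  induction ps generalizing h with
  | nil => cases hp
  | cons p ps ih =>
    rw [checkPatterns, Bool.and_eq_true, Bool.or_eq_true] at hc
    rw [zeroHints]
    rcases List.mem_cons.1 hp with rfl | hp
    · rcases hc.1 with h0 | h0
      · simp [h0]
      · rw [show vs.map (adjB G v) :: code (adjB G) vs = code (adjB G) (v :: vs) from rfl,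
          not_checkHint hL hG hvs] at h0
        cases h0
    · cases Nat.beq (h % 100) 0
      · exact ih hc.2 hp
      · exact List.mem_cons_of_mem _ (ih hc.2 hp)

theorem mem_patterns (p : List Bool) : p ∈ patterns p.length := by
  induction p with
  | nil => simp [patterns]
  | cons b p ih =>
    rw [List.length_cons, patterns, List.mem_flatMap]
    exact ⟨p, ih, by cases b <;> simp⟩

end Search

open SimpleGraph

section Colorings

variable {V : Type*}

/-- The colours of three vertices are admissible. -/
def IsGood (G : SimpleGraph V) (χ : V → Bool) (x y z : V) : Prop :=
  okTriple (χ x) (χ y) (χ z) (adjB G x y) (adjB G x z) (adjB G y z) = true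

/-- There is a colouring such that all triples are admissible. -/
def HasColoring (G : SimpleGraph V) : Prop :=
  ∃ χ : V → Bool, ∀ x y z, x ≠ y → x ≠ z → y ≠ z → IsGood G χ x y z

theorem okTriple_swap : ∀ a b c d e f, okTriple a b c d e f = okTriple b a c d f e := by
  decide

theorem okTriple_rotate : ∀ a b c d e f, okTriple a b c d e f = okTriple b c a f d e := by
  decide

theorem okTriple_not :
    ∀ a b c d e f, okTriple (!a) (!b) (!c) (!d) (!e) (!f) = okTriple a b c d e f := by
  decide

variable {G : SimpleGraph V} {χ : V → Bool} {x y z : V}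

theorem IsGood.swap (h : IsGood G χ x y z) : IsGood G χ y x z := by
  rw [IsGood, okTriple_swap] at h
  rwa [IsGood, adjB_comm G y x]

theorem IsGood.rotate (h : IsGood G χ x y z) : IsGood G χ y z x := by
  rw [IsGood, okTriple_rotate] at h
  rwa [IsGood, adjB_comm G y x, adjB_comm G z x]

theorem IsGood.compl (hxy : x ≠ y) (hxz : x ≠ z) (hyz : y ≠ z) (h : IsGood G χ x y z) :
    IsGood Gᶜ (fun v => !χ v) x y z := by
  rw [IsGood, adjB_compl G hxy, adjB_compl G hxz, adjB_compl G hyz, okTriple_not]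
  exact h

theorem HasColoring.compl (h : HasColoring G) : HasColoring Gᶜ := by
  obtain ⟨χ, h⟩ := h
  exact ⟨fun v => !χ v, fun x y z hxy hxz hyz => (h x y z hxy hxz hyz).compl hxy hxz hyz⟩

theorem hasColoring_compl_iff : HasColoring Gᶜ ↔ HasColoring G :=
  ⟨fun h => by simpa using h.compl, HasColoring.compl⟩

theorem HasColoring.of_isIndContained {W : Type*} {H : SimpleGraph W} (h : HasColoring H)
    (hG : G ⊴ H) : HasColoring G := by
  obtain ⟨χ, hχ⟩ := h
  obtain ⟨φ⟩ := hG
  refine ⟨χ ∘ φ, fun x y z hxy hxz hyz => ?_⟩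
  have := hχ (φ x) (φ y) (φ z) (φ.injective.ne hxy) (φ.injective.ne hxz) (φ.injective.ne hyz)
  have hadj : ∀ u v, adjB H (φ u) (φ v) = adjB G u v := fun u v => by
    rw [Bool.eq_iff_iff, adjB_eq_true, adjB_eq_true, φ.map_adj_iff]
  simpa only [IsGood, hadj, Function.comp_apply] using this

theorem okPair_map_iff {b b' e : Bool} {vs : List V} {u v : V → Bool} :
    okPair b b' e (vs.map χ) (vs.map u) (vs.map v) = true ↔
      ∀ x ∈ vs, okTriple (χ x) b b' (u x) (v x) e = true := by
  induction vs with
  | nil => simp [okPair]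
  | cons x vs ih =>
    rw [List.forall_mem_cons, ← ih, ← Bool.and_eq_true]
    rfl

theorem okVertex_map_iff {vs : List V} {v : V} {b : Bool} :
    okVertex b (vs.map χ) (code (adjB G) vs) (vs.map (adjB G v)) = true ↔
      vs.Pairwise fun x y =>
        okTriple (χ y) (χ x) b (adjB G x y) (adjB G v y) (adjB G v x) = true := by
  induction vs with
  | nil => simp [okVertex, code]
  | cons x vs ih =>
    rw [List.pairwise_cons, ← ih, ← okPair_map_iff, ← Bool.and_eq_true]
    rfl

theorem okVertex_iff {vs : List V} {v : V} (hvs : vs.Nodup) :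
    okVertex (χ v) (vs.map χ) (code (adjB G) vs) (vs.map (adjB G v)) = true ↔
      ∀ x ∈ vs, ∀ y ∈ vs, x ≠ y → IsGood G χ x y v := by
  have h : ∀ x y, okTriple (χ y) (χ x) (χ v) (adjB G x y) (adjB G v y) (adjB G v x) = true ↔
      IsGood G χ x y v := by
    intro x y
    rw [IsGood, okTriple_swap, adjB_comm G v x, adjB_comm G v y]
  simp only [okVertex_map_iff, h]
  constructor
  · intro hp x hx y hy hxy
    have : Std.Symm fun x y => IsGood G χ x y v := ⟨fun _ _ hab => hab.swap⟩
    exact hp.forall hx hy hxy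
  · intro hp
    exact List.Pairwise.imp_of_mem (fun hx hy hxy => hp _ hx _ hy hxy) hvs

theorem okColoring_iff {vs : List V} (hvs : vs.Nodup) :
    okColoring (vs.map χ) (code (adjB G) vs) = true ↔
      ∀ x ∈ vs, ∀ y ∈ vs, ∀ z ∈ vs, x ≠ y → x ≠ z → y ≠ z → IsGood G χ x y z := by
  induction vs with
  | nil => simp [okColoring, code]
  | cons v vs ih =>
    rw [List.nodup_cons] at hvs
    have h : okColoring ((v :: vs).map χ) (code (adjB G) (v :: vs)) =
      (okVertex (χ v) (vs.map χ) (code (adjB G) vs) (vs.map (adjB G v)) &&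
        okColoring (vs.map χ) (code (adjB G) vs)) := rfl
    rw [h, Bool.and_eq_true, okVertex_iff hvs.2, ih hvs.2]
    constructor
    · rintro ⟨h1, h2⟩ x hx y hy z hz hxy hxz hyz
      rcases List.mem_cons.1 hz with rfl | hz
      · exact h1 x ((List.mem_cons.1 hx).resolve_left hxz) y
          ((List.mem_cons.1 hy).resolve_left hyz) hxy
      rcases List.mem_cons.1 hx with rfl | hx
      · exact (h1 y ((List.mem_cons.1 hy).resolve_left hxy.symm) z
          ((List.mem_cons.1 hz).resolve_left hxz.symm) hyz).rotate.rotate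
      rcases List.mem_cons.1 hy with rfl | hy
      · exact (h1 z ((List.mem_cons.1 hz).resolve_left hyz.symm) x
          ((List.mem_cons.1 hx).resolve_left hxy) hxz.symm).rotate
      · exact h2 x hx y hy z hz hxy hxz hyz
    · intro h
      refine ⟨fun x hx y hy hxy => ?_, fun x hx y hy z hz => ?_⟩
      · refine h x (.tail _ hx) y (.tail _ hy) v (.head _) hxy ?_ ?_
        · rintro rfl; exact hvs.1 hx
        · rintro rfl; exact hvs.1 hy
      · exact h x (.tail _ hx) y (.tail _ hy) z (.tail _ hz)

theorem exists_map_eq {β : Type*} [Inhabited β] {vs : List V} (hvs : vs.Nodup) {c : List β}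
    (hc : c.length = vs.length) : ∃ χ : V → β, vs.map χ = c := by
  classical
  induction vs generalizing c with
  | nil => exact ⟨fun _ => default, (List.length_eq_zero_iff.1 hc).symm⟩
  | cons v vs ih =>
    cases c with
    | nil => cases hc
    | cons b c =>
      rw [List.nodup_cons] at hvs
      obtain ⟨χ, h⟩ := ih hvs.2 (c := c) (by simpa using hc)
      refine ⟨Function.update χ v b, ?_⟩
      rw [List.map_cons, Function.update_self, ← h]
      congr 1
      refine List.map_congr_left fun w hw => Function.update_of_ne ?_ _ _
      rintro rfl; exact hvs.1 hw

theorem forall_mem_of_heads {α : Type*} {P : α → α → Prop} (hP : ∀ a b, P a b → P b a)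
    {T : List α} (h : ∀ t ∈ heads T, ∀ s ∈ t.2, P t.1 s) : ∀ t ∈ T, ∀ s ∈ T, P t s := by
  induction T with
  | nil => simp
  | cons a T ih =>
    simp only [heads, List.forall_mem_cons] at h
    simp only [List.forall_mem_cons]
    exact ⟨h.1, fun t ht => ⟨hP _ _ (h.1.2 t ht), ih h.2 t ht⟩⟩

theorem forall_mem_of_heads_heads {α : Type*} {P : α → α → α → Prop}
    (hP : ∀ a b c, P a b c → P b a c) (hP' : ∀ a b c, P a b c → P b c a) {T : List α}
    (h : ∀ t ∈ heads T, ∀ s ∈ heads t.2, ∀ w ∈ s.2, P t.1 s.1 w) :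
    ∀ t ∈ T, ∀ s ∈ T, ∀ w ∈ T, P t s w := by
  induction T with
  | nil => simp
  | cons a T ih =>
    rw [heads, List.forall_mem_cons] at h
    have ha : ∀ s ∈ a :: T, ∀ w ∈ a :: T, P a s w :=
      forall_mem_of_heads (fun b c hbc => hP _ _ _ (hP' _ _ _ (hP' _ _ _ hbc))) h.1
    intro t ht s hs w hw
    rcases List.mem_cons.1 ht with rfl | ht'
    · exact ha s hs w hw
    rcases List.mem_cons.1 hs with rfl | hs'
    · exact hP _ _ _ (ha t ht w hw)
    rcases List.mem_cons.1 hw with rfl | hw'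
    · exact hP' _ _ _ (ha t ht s hs)
    · exact ih h.2 t ht' s hs' w hw'

theorem mem_true_false (e : Bool) : e ∈ [true, false] := by
  cases e <;> simp

theorem mem_okEdges {c : List Bool} {t s : Bool × List Bool} {e : Bool}
    (h : okTypes c t s e = true) : e ∈ okEdges c t s := by
  rw [okEdges]
  cases e <;> cases h1 : okTypes c t s true <;> cases h2 : okTypes c t s false <;> simp_all

theorem mem_conflictPairs {c : List Bool} {f : List (List Bool)} {T : List (Bool × List Bool)}
    {t : (Bool × List Bool) × List (Bool × List Bool)} (ht : t ∈ heads T) {s : Bool × List Bool}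
    (hs : s ∈ t.2) {e : Bool} (h : okTypes c t.1 s e = false) :
    (e :: s.2) :: t.1.2 :: f ∈ conflictPairs c f T := by
  simp only [conflictPairs, List.mem_flatMap]
  exact ⟨t, ht, s, hs, e, mem_true_false e, by simp [h]⟩

theorem mem_conflictTriples {c : List Bool} {f : List (List Bool)} {T : List (Bool × List Bool)}
    {t s : (Bool × List Bool) × List (Bool × List Bool)} (ht : t ∈ heads T) (hs : s ∈ heads t.2)
    {w : Bool × List Bool} (hw : w ∈ s.2) {e e' e'' : Bool} (h1 : okTypes c t.1 s.1 e = true)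
    (h2 : okTypes c t.1 w e' = true) (h3 : okTypes c s.1 w e'' = true)
    (h : okTriple t.1.1 s.1.1 w.1 e e' e'' = false) :
    (e'' :: e' :: w.2) :: (e :: s.1.2) :: t.1.2 :: f ∈ conflictTriples c f T := by
  simp only [conflictTriples, List.mem_flatMap]
  exact ⟨t, ht, s, hs, e, mem_okEdges h1, w, hw, e', mem_okEdges h2, e'', mem_true_false e'',
    by simp [h, h3]⟩

/-- A graph that contains a verified seed has a colouring. -/
theorem Seed.hasColoring {L : List (List (List Bool))} (hL : ∀ f ∈ L, IsCode f)
    (hG : Free L G) {s : Seed} (hs : s.check L = true) (h : Contains G s.graph) :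
    HasColoring G := by
  classical
  obtain ⟨vs, hvs, hcode⟩ := h
  have hlen : s.rows.length = vs.length := by
    rw [← length_code (adjB G) vs, hcode, Seed.graph, length_decode]
  obtain ⟨χ₀, hχ₀⟩ := exists_map_eq hvs (c := s.colors) (by rw [Seed.colors, length_bits, hlen])
  simp only [Seed.check, Bool.and_eq_true, ← hcode, hlen, List.all_eq_true] at hs
  obtain ⟨hs0, hs1, hs2, hs3, hs4⟩ := hs
  let χ : V → Bool := fun v => if v ∈ vs then χ₀ v else
    okVertex true s.colors s.graph (vs.map (adjB G v))
  have hχ : vs.map χ = s.colors := by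
    rw [← hχ₀]
    exact List.map_congr_left fun v hv => if_pos hv
  have htype : ∀ v, v ∉ vs → (χ v, vs.map (adjB G v)) ∈ s.types := by
    intro v hv
    rw [Seed.types, List.mem_map]
    refine ⟨vs.map (adjB G v), ?_, ?_⟩
    · rw [hlen]
      refine mem_zeroHints_of_checkPatterns hL hG (List.nodup_cons.2 ⟨hv, hvs⟩) hs1 ?_
      simpa using mem_patterns (vs.map (adjB G v))
    · simp only [χ, if_neg hv]
  rw [← hχ] at hs0 hs2 hs3 hs4
  have hok : ∀ u v, okTypes (vs.map χ) (χ u, vs.map (adjB G u)) (χ v, vs.map (adjB G v))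
      (adjB G u v) = true ↔ ∀ x ∈ vs, IsGood G χ x u v := by
    intro u v
    change okPair (χ u) (χ v) (adjB G u v) (vs.map χ) (vs.map (adjB G u)) (vs.map (adjB G v)) = true
      ↔ _
    rw [okPair_map_iff]
    refine forall₂_congr fun x _ => ?_
    rw [IsGood, adjB_comm G x u, adjB_comm G x v]
  have g3 := (okColoring_iff hvs).1 hs0
  have g2 : ∀ v, v ∉ vs → ∀ x ∈ vs, ∀ y ∈ vs, x ≠ y → IsGood G χ x y v := fun v hv =>
    (okVertex_iff hvs).1 (hs2 _ (htype v hv))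
  have g1 : ∀ u, u ∉ vs → ∀ v, v ∉ vs → u ≠ v → ∀ x ∈ vs, IsGood G χ x u v := by
    have := forall_mem_of_heads (T := s.types) (P := fun t t' => ∀ u v, u ∉ vs → v ∉ vs → u ≠ v →
      (χ u, vs.map (adjB G u)) = t → (χ v, vs.map (adjB G v)) = t' → ∀ x ∈ vs, IsGood G χ x u v)
      (fun t t' h u v hu hv huv ht ht' x hx =>
        (h v u hv hu huv.symm ht' ht x hx).rotate.rotate.swap.rotate.rotate.rotate)
      ?_
    · exact fun u hu v hv huv => this _ (htype u hu) _ (htype v hv) u v hu hv huv rfl rfl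
    · rintro ⟨t, l⟩ ht t' ht' u v hu hv huv rfl rfl
      rw [← hok, ← Bool.not_eq_false]
      intro hbad
      exact not_mem_of_checkHints hL hG hs3 (vs := v :: u :: vs)
        (by simp [hu, hv, huv.symm, hvs])
        (by simpa [code, adjB_comm G v u] using mem_conflictPairs ht ht' hbad)
  have g0 : ∀ u, u ∉ vs → ∀ v, v ∉ vs → ∀ w, w ∉ vs → u ≠ v → u ≠ w → v ≠ w →
      IsGood G χ u v w := by
    have := forall_mem_of_heads_heads (T := s.types)
      (P := fun t t' t'' => ∀ u v w, u ∉ vs → v ∉ vs → w ∉ vs → u ≠ v → u ≠ w → v ≠ w →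
        (χ u, vs.map (adjB G u)) = t → (χ v, vs.map (adjB G v)) = t' →
        (χ w, vs.map (adjB G w)) = t'' → IsGood G χ u v w)
      (fun t t' t'' h u v w hu hv hw huv huw hvw ht ht' ht'' =>
        (h v u w hv hu hw huv.symm hvw huw ht' ht ht'').swap)
      (fun t t' t'' h u v w hu hv hw huv huw hvw ht ht' ht'' =>
        (h w u v hw hu hv huw.symm hvw.symm huv ht'' ht ht').rotate)
      ?_
    · exact fun u hu v hv w hw huv huw hvw =>
        this _ (htype u hu) _ (htype v hv) _ (htype w hw) u v w hu hv hw huv huw hvw rfl rfl rfl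
    · rintro ⟨t, l⟩ ht ⟨t', l'⟩ ht' t'' ht'' u v w hu hv hw huv huw hvw rfl rfl rfl
      rw [IsGood, ← Bool.not_eq_false]
      intro hbad
      exact not_mem_of_checkHints hL hG hs4 (vs := w :: v :: u :: vs)
        (by simp [hu, hv, hw, huv.symm, huw.symm, hvw.symm, hvs])
        (by
          have := mem_conflictTriples (f := code (adjB G) vs) ht ht' ht''
            ((hok u v).2 (g1 u hu v hv huv)) ((hok u w).2 (g1 u hu w hw huw))
            ((hok v w).2 (g1 v hv w hw hvw)) hbad
          simpa [code, adjB_comm G v u, adjB_comm G w u, adjB_comm G w v] using this)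
  refine ⟨χ, fun x y z hxy hxz hyz => ?_⟩
  by_cases hx : x ∈ vs <;> by_cases hy : y ∈ vs <;> by_cases hz : z ∈ vs
  · exact g3 x hx y hy z hz hxy hxz hyz
  · exact g2 z hz x hx y hy hxy
  · exact (g2 y hy z hz x hx hxz.symm).rotate
  · exact g1 y hy z hz hyz x hx
  · exact (g2 x hx y hy z hz hyz).rotate.rotate
  · exact (g1 z hz x hx hxz.symm y hy).rotate.rotate
  · exact (g1 x hx y hy hxy z hz).rotate
  · exact g0 x hx y hy z hz hxy hxz hyz

theorem Free.compl {L : List (List (List Bool))} (h : Free L G) : Free L Gᶜ :=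
  fun f hf => ⟨(h f hf).2, by simpa using (h f hf).1⟩

theorem free_of_checkSeeds {L : List (List (List Bool))} (hL : ∀ f ∈ L, IsCode f)
    (hG : Free L G) (hχ : ¬ HasColoring G) {ss : List Seed} (hs : checkSeeds L ss = true) :
    Free (L ++ ss.map Seed.graph) G := by
  induction ss generalizing L with
  | nil => simpa using hG
  | cons s ss ih =>
    rw [checkSeeds, Bool.and_eq_true] at hs
    rw [List.map_cons, List.append_cons]
    refine ih ?_ ?_ hs.2
    · intro f hf
      rcases List.mem_append.1 hf with hf | hf
      · exact hL f hf
      · rw [List.mem_singleton.1 hf]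
        exact isCode_decode _
    · intro f hf
      rcases List.mem_append.1 hf with hf | hf
      · exact hG f hf
      · rw [List.mem_singleton.1 hf]
        exact ⟨fun h => hχ (s.hasColoring hL hG hs.1 h),
          fun h => hχ (hasColoring_compl_iff.1 (s.hasColoring hL hG.compl hs.1 h))⟩

end Colorings

open SimpleGraph

section Split

variable {V : Type*}

/-- A graph without induced `2K₂`, `C₄` and `C₅` is a split graph (Földes and Hammer). -/
theorem exists_isClique_isIndepSet [Finite V] (G : SimpleGraph V)
    (h2K2 : ∀ a b c d, G.Adj a b → G.Adj c d → a ≠ c → a ≠ d → b ≠ c → b ≠ d →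
      ¬ G.Adj a c → ¬ G.Adj a d → ¬ G.Adj b c → ¬ G.Adj b d → False)
    (hC4 : ∀ a b c d, G.Adj a b → G.Adj b c → G.Adj c d → G.Adj d a → a ≠ c → b ≠ d →
      ¬ G.Adj a c → ¬ G.Adj b d → False)
    (hC5 : ∀ a b c d e, G.Adj a b → G.Adj b c → G.Adj c d → G.Adj d e → G.Adj e a →
      a ≠ c → a ≠ d → b ≠ d → b ≠ e → c ≠ e →
      ¬ G.Adj a c → ¬ G.Adj a d → ¬ G.Adj b d → ¬ G.Adj b e → ¬ G.Adj c e → False) :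
    ∃ K : Set V, G.IsClique K ∧ G.IsIndepSet Kᶜ := by
  classical
  have := Fintype.ofFinite V
  obtain ⟨K, hK, hmax⟩ := (Finset.univ.filter fun K : Finset V => G.IsClique (K : Set V)).exists_max_image
    (fun K => ∑ v ∈ K, (1 + G.degree v)) ⟨∅, by simp⟩
  simp only [Finset.mem_filter, Finset.mem_univ, true_and] at hK hmax
  have hadj : ∀ a ∈ K, ∀ b ∈ K, a ≠ b → G.Adj a b := fun a ha b hb hab => hK ha hb hab
  refine ⟨K, hK, ?_⟩
  have hnon : ∀ x ∉ K, ∃ u ∈ K, ¬ G.Adj x u := by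
    intro x hx
    by_contra! h
    have := hmax (insert x K) (by
      rw [Finset.coe_insert, SimpleGraph.isClique_insert]
      exact ⟨hK, fun b hb _ => h b hb⟩)
    rw [Finset.sum_insert hx] at this
    omega
  have hswap : ∀ x ∉ K, ∀ u ∈ K, (∀ w ∈ K, w ≠ u → G.Adj x w) → G.degree x ≤ G.degree u := by
    intro x hx u hu h
    have := hmax (insert x (K.erase u)) (by
      rw [Finset.coe_insert, SimpleGraph.isClique_insert]
      refine ⟨hK.subset (by simp), fun b hb _ => ?_⟩
      rw [Finset.mem_coe, Finset.mem_erase] at hb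
      exact h b hb.2 hb.1)
    rw [Finset.sum_insert (by simp [hx]), ← Finset.add_sum_erase K _ hu] at this
    omega
  -- The non-neighbourhoods of `x` and `y` in `K` are nested.
  have main : ∀ x ∉ K, ∀ y ∉ K, G.Adj x y → (∀ u ∈ K, ¬ G.Adj x u → ¬ G.Adj y u) → False := by
    intro x hx y hy hxy hsub
    obtain ⟨u, hu, hxu⟩ := hnon x hx
    have hyu := hsub u hu hxu
    have hxK : ∀ a ∈ K, x ≠ a := by rintro a ha rfl; exact hx ha
    have hyK : ∀ a ∈ K, y ≠ a := by rintro a ha rfl; exact hy ha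
    have hxw : ∀ w ∈ K, w ≠ u → G.Adj x w := by
      intro w hw hwu
      by_contra hxw
      exact h2K2 x y u w hxy (hadj u hu w hw hwu.symm) (hxK u hu) (hxK w hw) (hyK u hu) (hyK w hw)
        hxu hxw hyu (hsub w hw hxw)
    obtain ⟨z, huz, hxz⟩ : ∃ z, G.Adj u z ∧ ¬ G.Adj x z := by
      by_contra! h
      refine (hswap x hx u hu hxw).not_gt (Finset.card_lt_card ?_)
      rw [Finset.ssubset_iff_of_subset fun z hz => by simpa using h z (by simpa using hz)]
      exact ⟨y, by simpa using hxy, by simpa using fun h => hyu h.symm⟩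
    have hzK : z ∉ K := fun hz => hxz (hxw z hz huz.ne')
    have hzx : z ≠ x := by rintro rfl; exact hxu huz.symm
    have hzy : z ≠ y := by rintro rfl; exact hyu huz.symm
    by_cases hyz : G.Adj y z
    · obtain ⟨w, hw, hzw⟩ := hnon z hzK
      have hwu : w ≠ u := by rintro rfl; exact hzw huz.symm
      have hzw' : z ≠ w := by rintro rfl; exact hzK hw
      by_cases hyw : G.Adj y w
      · exact hC4 y z u w hyz huz.symm (hadj u hu w hw hwu.symm) hyw.symm (hyK u hu) hzw' hyu hzw
      · exact hC5 x y z u w hxy hyz huz.symm (hadj u hu w hw hwu.symm) (hxw w hw hwu).symm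
          hzx.symm (hxK u hu) (hyK u hu) (hyK w hw) hzw' hxz hxu hyu hyw hzw
    · exact h2K2 x y u z hxy huz (hxK u hu) hzx.symm (hyK u hu) hzy.symm hxu hxz hyu hyz
  intro x hx y hy _ hxy
  by_cases h : ∀ u ∈ K, ¬ G.Adj x u → ¬ G.Adj y u
  · exact main x hx y hy hxy h
  · push Not at h
    obtain ⟨u, hu, hxu, hyu⟩ := h
    refine main y hy x hx hxy.symm fun w hw hyw hxw => ?_
    have hwu : w ≠ u := by rintro rfl; exact hyw hyu
    exact hC4 x y u w hxy hyu (hadj u hu w hw hwu.symm) hxw.symm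
      (by rintro rfl; exact hx hu) (by rintro rfl; exact hy hw) hxu hyw

theorem hasColoring_of_isClique_isIndepSet {G : SimpleGraph V} {K : Set V} (hK : G.IsClique K)
    (hI : G.IsIndepSet Kᶜ) : HasColoring G := by
  classical
  refine ⟨fun v => decide (v ∉ K), fun x y z hxy hxz hyz => ?_⟩
  have h1 : ∀ x y, x ≠ y → x ∈ K → y ∈ K → adjB G x y = true := fun x y hxy hx hy =>
    adjB_eq_true.2 (hK hx hy hxy)
  have h2 : ∀ x y, x ≠ y → x ∉ K → y ∉ K → adjB G x y = false := fun x y hxy hx hy =>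
    adjB_eq_false.2 (hI hx hy hxy)
  rw [IsGood]
  by_cases hx : x ∈ K <;> by_cases hy : y ∈ K <;> by_cases hz : z ∈ K <;>
    simp [hx, hy, hz, okTriple, h1 x y hxy, h1 x z hxz, h1 y z hyz, h2 x y hxy, h2 x z hxz,
      h2 y z hyz]

end Split

open SimpleGraph

section Doubled

variable {V : Type u}

theorem M_adj_unique {a : ℕ} {x y z : (Fin a × Bool) ⊕ Fin 0} (hy : (M a 0).Adj x y)
    (hz : (M a 0).Adj x z) : y = z := by
  obtain ⟨i, s, t, rfl, rfl, hst⟩ := hy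
  obtain ⟨j, s', t', h, rfl, hst'⟩ := hz
  simp only [Sum.inl.injEq, Prod.mk.injEq] at h ⊢
  obtain ⟨rfl, rfl⟩ := h
  exact ⟨rfl, by cases s <;> cases t <;> cases t' <;> simp_all⟩

theorem IsMatched.adj_unique {G : SimpleGraph V} {A : Set V} (h : IsMatched (G.induce A))
    {x y z : V} (hx : x ∈ A) (hy : y ∈ A) (hz : z ∈ A) (hxy : G.Adj x y) (hxz : G.Adj x z) :
    y = z := by
  obtain ⟨a, ⟨e⟩⟩ := h
  have h1 : (M a 0).Adj (e ⟨x, hx⟩) (e ⟨y, hy⟩) := e.map_adj_iff.2 hxy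
  have h2 : (M a 0).Adj (e ⟨x, hx⟩) (e ⟨z, hz⟩) := e.map_adj_iff.2 hxz
  simpa using e.injective (M_adj_unique h1 h2)

theorem IsAntimatched.adj_unique {G : SimpleGraph V} {B : Set V} (h : IsAntimatched (G.induce B))
    {x y z : V} (hx : x ∈ B) (hy : y ∈ B) (hz : z ∈ B) (hxy : x ≠ y) (hxz : x ≠ z)
    (h1 : ¬ G.Adj x y) (h2 : ¬ G.Adj x z) : y = z := by
  obtain ⟨a, ⟨e⟩⟩ := h
  have key : ∀ y (hy : y ∈ B), x ≠ y → ¬ G.Adj x y → (M a 0).Adj (e ⟨x, hx⟩) (e ⟨y, hy⟩) := by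
    intro y hy hxy h
    have h3 : ¬ (M a 0)ᶜ.Adj (e ⟨x, hx⟩) (e ⟨y, hy⟩) := fun h' => h (e.map_adj_iff.1 h')
    rw [compl_adj, not_and, not_not] at h3
    exact h3 (e.injective.ne (by simpa using hxy))
  simpa using e.injective (M_adj_unique (key y hy hxy h1) (key z hz hxz h2))

theorem IsDoubleSplit.hasColoring {G : SimpleGraph V} (h : IsDoubleSplit G) : HasColoring G := by
  classical
  obtain ⟨A, B, -, hAB, hA, hB, hal⟩ := h
  have hmem : ∀ v, v ∉ A → v ∈ B := fun v hv =>
    (show v ∈ A ∪ B from hAB ▸ Set.mem_univ v).resolve_left hv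
  have hAAA : ∀ x ∈ A, ∀ y ∈ A, ∀ z ∈ A, y ≠ z → ¬ (adjB G x y = true ∧ adjB G x z = true) := by
    intro x hx y hy z hz hyz h
    simp only [adjB_eq_true] at h
    exact hyz (hA.adj_unique hx hy hz h.1 h.2)
  have hBBB : ∀ x ∉ A, ∀ y ∉ A, ∀ z ∉ A, x ≠ y → x ≠ z → y ≠ z →
      ¬ (adjB G x y = false ∧ adjB G x z = false) := by
    intro x hx y hy z hz hxy hxz hyz h
    simp only [adjB_eq_false] at h
    exact hyz (hB.adj_unique (hmem x hx) (hmem y hy) (hmem z hz) hxy hxz h.1 h.2)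
  have hAAB : ∀ x ∈ A, ∀ y ∈ A, ∀ z ∉ A, adjB G x y = true → adjB G x z = !adjB G y z := by
    intro x hx y hy z hz h
    have := hal.edge x hx y hy (adjB_eq_true.1 h) z (hmem z hz)
    rw [adjB_comm G x, adjB_comm G y]
    rcases this with h | h <;> simp [adjB, h]
  have hABB : ∀ x ∈ A, ∀ y ∉ A, ∀ z ∉ A, y ≠ z → adjB G y z = false →
      adjB G x y = !adjB G x z := by
    intro x hx y hy z hz hyz h
    have := hal.nonedge x hx y (hmem y hy) z (hmem z hz) hyz (adjB_eq_false.1 h)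
    rcases this with h | h <;> simp [adjB, h]
  refine ⟨fun v => decide (v ∈ A), ?_⟩
  have g3 : ∀ x ∈ A, ∀ y ∈ A, ∀ z ∈ A, x ≠ y → x ≠ z → y ≠ z →
      IsGood G (fun v => decide (v ∈ A)) x y z := by
    intro x hx y hy z hz hxy hxz hyz
    have h1 := hAAA x hx y hy z hz hyz
    have h2 := hAAA y hy x hx z hz hxz
    have h3 := hAAA z hz x hx y hy hxy
    rw [adjB_comm G y x] at h2
    rw [adjB_comm G z x, adjB_comm G z y] at h3
    simp only [IsGood, hx, hy, hz, decide_true]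
    revert h1 h2 h3
    generalize adjB G x y = a, adjB G x z = b, adjB G y z = c
    revert a b c; decide
  have g0 : ∀ x ∉ A, ∀ y ∉ A, ∀ z ∉ A, x ≠ y → x ≠ z → y ≠ z →
      IsGood G (fun v => decide (v ∈ A)) x y z := by
    intro x hx y hy z hz hxy hxz hyz
    have h1 := hBBB x hx y hy z hz hxy hxz hyz
    have h2 := hBBB y hy x hx z hz hxy.symm hyz hxz
    have h3 := hBBB z hz x hx y hy hxz.symm hyz.symm hxy
    rw [adjB_comm G y x] at h2
    rw [adjB_comm G z x, adjB_comm G z y] at h3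
    simp only [IsGood, hx, hy, hz, decide_false]
    revert h1 h2 h3
    generalize adjB G x y = a, adjB G x z = b, adjB G y z = c
    revert a b c; decide
  have g2 : ∀ x ∈ A, ∀ y ∈ A, ∀ z ∉ A, IsGood G (fun v => decide (v ∈ A)) x y z := by
    intro x hx y hy z hz
    have h1 := hAAB x hx y hy z hz
    simp only [IsGood, hx, hy, hz, decide_true, decide_false]
    revert h1
    generalize adjB G x y = a, adjB G x z = b, adjB G y z = c
    revert a b c; decide
  have g1 : ∀ x ∈ A, ∀ y ∉ A, ∀ z ∉ A, y ≠ z → IsGood G (fun v => decide (v ∈ A)) x y z := by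
    intro x hx y hy z hz hyz
    have h1 := hABB x hx y hy z hz hyz
    simp only [IsGood, hx, hy, hz, decide_true, decide_false]
    revert h1
    generalize adjB G x y = a, adjB G x z = b, adjB G y z = c
    revert a b c; decide
  intro x y z hxy hxz hyz
  by_cases hx : x ∈ A <;> by_cases hy : y ∈ A <;> by_cases hz : z ∈ A
  · exact g3 x hx y hy z hz hxy hxz hyz
  · exact g2 x hx y hy z hz
  · exact (g2 z hz x hx y hy).rotate
  · exact g1 x hx y hy z hz hyz
  · exact (g2 y hy z hz x hx).rotate.rotate
  · exact (g1 y hy x hx z hz hxz).swap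
  · exact (g1 z hz x hx y hy hxy).rotate
  · exact g0 x hx y hy z hz hxy hxz hyz

/-- Adding partners to the vertices of a set in which each vertex has at most one neighbour: the
vertices of the set correspond to pairs of a representative and a sign. -/
theorem exists_representatives [Finite V] (G : SimpleGraph V) (A : Set V)
    (h : ∀ x ∈ A, ∀ y ∈ A, ∀ z ∈ A, G.Adj x y → G.Adj x z → y = z) :
    ∃ (I : Set V) (r : A → I × Bool), I ⊆ A ∧ Function.Injective r ∧
      (∀ v, ((r v).2 = false ∧ (r v).1.1 = v.1) ∨ ((r v).2 = true ∧ G.Adj (r v).1.1 v.1)) ∧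
      ∀ v w, G.Adj v.1 w.1 ↔ (r v).1 = (r w).1 ∧ (r v).2 ≠ (r w).2 := by
  classical
  obtain ⟨n, ⟨e⟩⟩ := Finite.exists_equiv_fin V
  let I : Set V := {v | v ∈ A ∧ ∀ u ∈ A, G.Adj v u → e v < e u}
  have hr : ∀ v : A, ∃ p : I × Bool,
      (p.2 = false ∧ p.1.1 = v.1) ∨ (p.2 = true ∧ G.Adj p.1.1 v.1) := by
    rintro ⟨v, hv⟩
    by_cases hvI : v ∈ I
    · exact ⟨(⟨v, hvI⟩, false), .inl ⟨rfl, rfl⟩⟩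
    · have : ∃ u ∈ A, G.Adj v u ∧ e u ≤ e v := by
        by_contra! h'
        exact hvI ⟨hv, h'⟩
      obtain ⟨u, hu, hvu, hle⟩ := this
      refine ⟨(⟨u, hu, fun w hw huw => ?_⟩, true), .inr ⟨rfl, hvu.symm⟩⟩
      rw [h u hu w hw v hv huw hvu.symm]
      exact lt_of_le_of_ne hle (e.injective.ne hvu.ne')
  choose r hr using hr
  have hadj : ∀ v w : A, (r v).2 = false → (r w).2 = true → (r v).1 = (r w).1 →
      G.Adj v.1 w.1 := by
    intro v w hv hw hvw
    have h1 := (hr v).resolve_right (by simp [hv])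
    have h2 := (hr w).resolve_left (by simp [hw])
    rw [← h1.2, hvw]
    exact h2.2
  have hfalse : ∀ v : A, v.1 ∈ I → (r v).2 = false ∧ (r v).1.1 = v.1 := by
    intro v hv
    refine (hr v).resolve_right fun h' => ?_
    have h1 := hv.2 _ (r v).1.2.1 h'.2.symm
    exact lt_asymm h1 ((r v).1.2.2 _ v.2 h'.2)
  have hlt : ∀ v w : A, G.Adj v.1 w.1 → e v.1 < e w.1 →
      (r v).1 = (r w).1 ∧ (r v).2 ≠ (r w).2 := by
    intro v w hvw hlt
    have hv := hfalse v ⟨v.2, fun u hu hvu => by rwa [h v.1 v.2 u hu w.1 w.2 hvu hvw]⟩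
    have hw := (hr w).resolve_left (by
      rintro ⟨-, h1⟩
      have := (r w).1.2.2 v.1 v.2 (by rw [h1]; exact hvw.symm)
      rw [h1] at this
      exact lt_asymm hlt this)
    refine ⟨Subtype.ext ?_, by simp [hv.1, hw.1]⟩
    rw [hv.2]
    exact h w.1 w.2 _ v.2 _ (r w).1.2.1 hvw.symm hw.2.symm
  refine ⟨I, r, fun v hv => hv.1, ?_, hr, fun v w => ⟨fun hvw => ?_, ?_⟩⟩
  · intro v w hvw
    have hw := hr w
    rw [← hvw] at hw
    rcases hr v with h1 | h1
    · have h2 := hw.resolve_right (by simp [h1.1])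
      exact Subtype.ext (h1.2.symm.trans h2.2)
    · have h2 := hw.resolve_left (by simp [h1.1])
      exact Subtype.ext (h _ (r v).1.2.1 _ v.2 _ w.2 h1.2 h2.2)
  · rcases lt_or_gt_of_ne (e.injective.ne hvw.ne) with h' | h'
    · exact hlt v w hvw h'
    · exact ⟨(hlt w v hvw.symm h').1.symm, (hlt w v hvw.symm h').2.symm⟩
  · rintro ⟨h1, h2⟩
    cases hv : (r v).2 with
    | false => exact hadj v w hv (by simpa [hv] using h2) h1
    | true => exact (hadj w v (by simpa [hv] using h2) hv h1.symm).symm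

/-- The double-split graph with pairs indexed by `I` and antipairs indexed by `J`. -/
def doubleSplit {I J : Type u} (a : I → J → Bool) : SimpleGraph ((I × Bool) ⊕ (J × Bool)) where
  Adj
    | .inl p, .inl q => p.1 = q.1 ∧ p.2 ≠ q.2
    | .inr p, .inr q => p.1 ≠ q.1
    | .inl p, .inr q => xor (a p.1 q.1) (xor p.2 q.2) = true
    | .inr q, .inl p => xor (a p.1 q.1) (xor p.2 q.2) = true
  symm := ⟨by
    rintro (p | p) (q | q) h
    · exact ⟨h.1.symm, h.2.symm⟩
    · exact h
    · exact h
    · exact Ne.symm h⟩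
  loopless := ⟨by rintro (p | p) h; exacts [h.2 rfl, h rfl]⟩

/-- The vertices of `M a 0`. -/
def matchedEquiv {I W : Type u} {a : ℕ} (e : I ≃ Fin a) {S : Set W} (f : S ≃ I × Bool) :
    S ≃ (Fin a × Bool) ⊕ Fin 0 :=
  f.trans ((e.prodCongr (Equiv.refl Bool)).trans (Equiv.sumEmpty _ _).symm)

theorem M_adj_matchedEquiv_iff {I W : Type u} {a : ℕ} (e : I ≃ Fin a) {S : Set W}
    (f : S ≃ I × Bool) (x y : S) :
    (M a 0).Adj (matchedEquiv e f x) (matchedEquiv e f y) ↔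
      (f x).1 = (f y).1 ∧ (f x).2 ≠ (f y).2 := by
  constructor
  · rintro ⟨i, s, t, hx, hy, h⟩
    have hx : (e (f x).1, (f x).2) = (i, s) := Sum.inl_injective hx
    have hy : (e (f y).1, (f y).2) = (i, t) := Sum.inl_injective hy
    simp only [Prod.mk.injEq] at hx hy
    exact ⟨e.injective (hx.1.trans hy.1.symm), by rwa [hx.2, hy.2]⟩
  · rintro ⟨h1, h2⟩
    exact ⟨e (f x).1, (f x).2, (f y).2, rfl, by rw [h1]; rfl, h2⟩

theorem isDoubleSplit_doubleSplit {I J : Type u} [Finite I] [Finite J] (a : I → J → Bool) :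
    IsDoubleSplit (doubleSplit a) := by
  obtain ⟨m, ⟨e⟩⟩ := Finite.exists_equiv_fin I
  obtain ⟨n, ⟨e'⟩⟩ := Finite.exists_equiv_fin J
  have hA : IsMatched ((doubleSplit a).induce (Set.range Sum.inl)) := by
    let f := (Equiv.ofInjective (Sum.inl : I × Bool → (I × Bool) ⊕ (J × Bool)) Sum.inl_injective).symm
    refine ⟨m, ⟨⟨matchedEquiv e f, fun {x y} => ?_⟩⟩⟩
    obtain ⟨p, rfl⟩ := f.symm.surjective x
    obtain ⟨q, rfl⟩ := f.symm.surjective y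
    rw [M_adj_matchedEquiv_iff, f.apply_symm_apply, f.apply_symm_apply]
    rfl
  have hB : IsAntimatched ((doubleSplit a).induce (Set.range Sum.inr)) := by
    let f := (Equiv.ofInjective (Sum.inr : J × Bool → (I × Bool) ⊕ (J × Bool)) Sum.inr_injective).symm
    refine ⟨n, ⟨⟨matchedEquiv e' f, fun {x y} => ?_⟩⟩⟩
    obtain ⟨p, rfl⟩ := f.symm.surjective x
    obtain ⟨q, rfl⟩ := f.symm.surjective y
    rw [compl_adj, M_adj_matchedEquiv_iff, f.apply_symm_apply, f.apply_symm_apply,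
      (matchedEquiv e' f).injective.ne_iff, f.symm.injective.ne_iff]
    change _ ↔ p.1 ≠ q.1
    rw [ne_eq, Prod.ext_iff]
    tauto
  have hdisj : Disjoint (Set.range (Sum.inl : I × Bool → (I × Bool) ⊕ (J × Bool)))
      (Set.range Sum.inr) := Set.isCompl_range_inl_range_inr.disjoint
  refine ⟨Set.range Sum.inl, Set.range Sum.inr, hdisj, Set.range_inl_union_range_inr, hA, hB,
    hdisj, hA.imp fun m h => ⟨0, h⟩, hB.imp fun n h => ⟨0, h⟩, ?_, ?_⟩
  · rintro _ ⟨⟨i, s⟩, rfl⟩ _ ⟨⟨i', s'⟩, rfl⟩ ⟨h, h'⟩ _ ⟨⟨j, t⟩, rfl⟩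
    obtain rfl : i = i' := h
    have key : ∀ b s s' t : Bool, s ≠ s' →
        Xor (xor b (xor s t) = true) (xor b (xor s' t) = true) := by decide
    exact key _ _ _ _ h'
  · rintro _ ⟨⟨i, s⟩, rfl⟩ _ ⟨⟨j, t⟩, rfl⟩ _ ⟨⟨j', t'⟩, rfl⟩ h h'
    obtain rfl : j = j' := not_not.1 h'
    have key : ∀ b s t t' : Bool, t ≠ t' →
        Xor (xor b (xor s t) = true) (xor b (xor s t') = true) := by decide
    exact key _ _ _ _ (by rintro rfl; exact h rfl)

theorem HasColoring.isDoubled [Finite V] {G : SimpleGraph V} (h : HasColoring G) :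
    IsDoubled G := by
  classical
  obtain ⟨χ, hχ⟩ := h
  have hne : ∀ {x y}, χ x = true → χ y = false → x ≠ y := by
    rintro x _ hx hy rfl
    rw [hx] at hy
    cases hy
  have hA : ∀ x ∈ {v | χ v = true}, ∀ y ∈ {v | χ v = true}, ∀ z ∈ {v | χ v = true},
      G.Adj x y → G.Adj x z → y = z := by
    intro x hx y hy z hz hxy hxz
    by_contra hyz
    have := hχ x y z hxy.ne hxz.ne hyz
    rw [IsGood, hx, hy, hz, adjB_eq_true.2 hxy, adjB_eq_true.2 hxz] at this
    cases this
  have hB : ∀ x ∈ {v | χ v = false}, ∀ y ∈ {v | χ v = false}, ∀ z ∈ {v | χ v = false},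
      Gᶜ.Adj x y → Gᶜ.Adj x z → y = z := by
    intro x hx y hy z hz hxy hxz
    by_contra hyz
    have := hχ x y z hxy.ne hxz.ne hyz
    rw [compl_adj, ← adjB_eq_false] at hxy hxz
    rw [IsGood, hx, hy, hz, hxy.2, hxz.2] at this
    cases this
  have hAAB : ∀ x y z, χ x = true → χ y = true → χ z = false → G.Adj x y →
      adjB G y z = xor (adjB G x z) true := by
    intro x y z hx hy hz hxy
    have := hχ x y z hxy.ne (hne hx hz) (hne hy hz)
    rw [IsGood, hx, hy, hz, adjB_eq_true.2 hxy] at this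
    revert this
    generalize adjB G x z = b, adjB G y z = c
    revert b c; decide
  have hABB : ∀ x y z, χ x = true → χ y = false → χ z = false → Gᶜ.Adj y z →
      adjB G x z = xor (adjB G x y) true := by
    intro x y z hx hy hz hyz
    have := hχ x y z (hne hx hy) (hne hx hz) hyz.ne
    rw [compl_adj, ← adjB_eq_false] at hyz
    rw [IsGood, hx, hy, hz, hyz.2] at this
    revert this
    generalize adjB G x y = b, adjB G x z = c
    revert b c; decide
  obtain ⟨I, r, hI, hr, hr', hadj⟩ := exists_representatives G _ hA
  obtain ⟨J, r', hJ, hs, hs', hadj'⟩ := exists_representatives Gᶜ _ hB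
  have hcross : ∀ (v : {v | χ v = true}) (w : {v | χ v = false}),
      adjB G v.1 w.1 = xor (adjB G (r v).1.1 (r' w).1.1) (xor (r v).2 (r' w).2) := by
    intro v w
    have h1 : adjB G v.1 w.1 = xor (adjB G (r v).1.1 w.1) (r v).2 := by
      rcases hr' v with ⟨h, h'⟩ | ⟨h, h'⟩
      · rw [h, h', Bool.xor_false]
      · rw [h, hAAB _ _ _ (hI (r v).1.2) v.2 w.2 h']
    have h2 : adjB G (r v).1.1 w.1 = xor (adjB G (r v).1.1 (r' w).1.1) (r' w).2 := by
      rcases hs' w with ⟨h, h'⟩ | ⟨h, h'⟩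
      · rw [h, h', Bool.xor_false]
      · rw [h, hABB _ _ _ (hI (r v).1.2) (hJ (r' w).1.2) w.2 h']
    rw [h1, h2, Bool.xor_assoc, Bool.xor_comm (r' w).2]
  let φ : V → (I × Bool) ⊕ (J × Bool) := fun v =>
    if h : χ v = true then .inl (r ⟨v, h⟩) else .inr (r' ⟨v, by simpa using h⟩)
  have hφ : ∀ v (h : χ v = true), φ v = .inl (r ⟨v, h⟩) := fun v h => dif_pos h
  have hφ' : ∀ v (h : χ v = false), φ v = .inr (r' ⟨v, h⟩) := fun v h => dif_neg (by simp [h])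
  have hinj : Function.Injective φ := by
    intro v w hvw
    cases hv : χ v <;> cases hw : χ w
    · rw [hφ' v hv, hφ' w hw] at hvw
      simpa using hs (Sum.inr_injective hvw)
    · rw [hφ' v hv, hφ w hw] at hvw
      cases hvw
    · rw [hφ v hv, hφ' w hw] at hvw
      cases hvw
    · rw [hφ v hv, hφ w hw] at hvw
      simpa using hr (Sum.inl_injective hvw)
  refine ⟨_, inferInstance, doubleSplit fun (i : I) (j : J) => adjB G i.1 j.1,
    isDoubleSplit_doubleSplit _, ⟨⟨⟨φ, hinj⟩, fun {v w} => ?_⟩⟩⟩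
  change (doubleSplit _).Adj (φ v) (φ w) ↔ G.Adj v w
  cases hv : χ v <;> cases hw : χ w
  · rw [hφ' v hv, hφ' w hw]
    change (r' ⟨v, hv⟩).1 ≠ (r' ⟨w, hw⟩).1 ↔ _
    by_cases hvw : v = w
    · subst hvw; simp
    · have h1 := hadj' ⟨v, hv⟩ ⟨w, hw⟩
      have h2 := hs.ne (a₁ := ⟨v, hv⟩) (a₂ := ⟨w, hw⟩) (by simpa using hvw)
      rw [compl_adj] at h1
      rw [ne_eq, Prod.ext_iff] at h2
      simp only at h1
      tauto
  · rw [hφ' v hv, hφ w hw, G.adj_comm, ← adjB_eq_true (G := G), hcross ⟨w, hw⟩ ⟨v, hv⟩]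
    rfl
  · rw [hφ v hv, hφ' w hw, ← adjB_eq_true (G := G), hcross ⟨v, hv⟩ ⟨w, hw⟩]
    rfl
  · rw [hφ v hv, hφ w hw]
    exact (hadj ⟨v, hv⟩ ⟨w, hw⟩).symm

theorem isDoubled_iff_hasColoring [Finite V] {G : SimpleGraph V} :
    IsDoubled G ↔ HasColoring G :=
  ⟨fun ⟨_, _, _, h, h'⟩ => h.hasColoring.of_isIndContained h', HasColoring.isDoubled⟩

end Doubled

/-- Rows of codes of the graphs `F1`, `F23`, `F2`, …, `F22`. -/
def memberRows : List (List ℕ) :=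
  [[9, 1, 1, 1, 0],
   [46, 78, 22, 6, 8, 2, 3, 1, 0],
   [14, 7, 0, 0, 0],
   [1, 5, 1, 3, 0, 0],
   [5, 1, 1, 0, 1, 0],
   [1, 1, 5, 1, 1, 0],
   [29, 1, 1, 0, 1, 0],
   [0, 9, 0, 1, 0, 0],
   [16, 9, 0, 1, 0, 0],
   [0, 9, 4, 3, 0, 0],
   [16, 9, 4, 3, 0, 0],
   [0, 9, 4, 3, 1, 0],
   [16, 9, 4, 3, 1, 0],
   [33, 1, 1, 1, 1, 1, 0],
   [1, 17, 9, 5, 3, 0, 0],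
   [33, 17, 9, 5, 3, 0, 0],
   [33, 17, 9, 5, 3, 1, 0],
   [17, 1, 1, 1, 1, 0, 0],
   [46, 14, 6, 2, 0, 0, 0],
   [49, 17, 9, 5, 3, 1, 0],
   [17, 25, 13, 1, 1, 0, 0],
   [46, 6, 2, 2, 2, 0, 0],
   [110, 38, 62, 4, 6, 0, 1, 0, 0]]

/-- Codes of the graphs `F1`, `F23`, `F2`, …, `F22`. -/
def memberCodes : List (List (List Bool)) := memberRows.map decode

/-- Graphs whose colourings are determined by their restrictions, in an order such that each of
them can be excluded after the preceding ones. -/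
def seeds : List Seed :=
  [⟨[0, 1, 0, 1, 0], 31,
    151715170606151700000000192115170000000019210606192119212325,
    15150617072107051701010719010107051701013507210201010705173501010101071901020101010705,
    151515061519172115191721151915010606172115010606151915010606172115010606⟩,
   ⟨[8, 1, 1, 0, 1, 0], 43,
    47474747000006474747090906470606000600060000000000061113000000004709470900110613470909110613061347064706000000004706131300000000,
    64707471147110747074701010729010707012907070731310712121011114701020201010747010107074747290729010712471231121001314343141231141205313343121212331212050506010707010101010701010101110601010747074701074743290731014314431201431212311405012907471212014747122912121433314312121201121212331205120501010747472912124712291212121207330143121231121212123112051205120501314312123112120505311212121212120533331212103312120505331205120512050505,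
    11070129013101290133012901310131013301294712471206060131471247120606012947124712060601334712471206060129471247120606013147124712060601314712471206060133431243121246⟩,
   ⟨[4, 5, 1, 0, 1, 0], 39,
    47494701470947094906074749064706494749011107061101010000000029314727490101010911470607130101111347060601111306130101000000003133,
    1412100747074301050514124305121201050547121201010701120501011205,
    606060606060606⟩,
   ⟨[2, 7, 1, 0, 1, 0], 41,
    47514747004700474709470947514706490149510747000051015111071400000606491301010041010211110101080806010606470000000601061312120000,
    474747484848074807434848054108020202020744471249520652520906484847481214481212485212054812124806121214121205480812051205,
    471247120606471247120606471247120606481248124848⟩,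
   ⟨[3, 7, 1, 0, 1, 0], 41,
    47534747535300474753470953484706495149514353005351055148530553000602491301020008010151480101080806060606001200000605061312050000,
    474843050802020744125406524906484852144812481212104812480812121405481212121205,
    4712060648124848⟩,
   ⟨[10, 7, 1, 0, 1, 0], 37,
    47474747075355555102555507010806005300120556564802370252055656481106510501020205010200050101020506065312475442480200025212125448,
    65308055655564701010508,
    0⟩,
   ⟨[21, 5, 1, 0, 1, 0], 60,
    47474747070551560751055611565648070551560705585601020254020502480751055601020254075805560102054811565648010502480102054801050548,
    0,
    0⟩,
   ⟨[11, 7, 1, 0, 1, 0], 40,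
    47474747535355555353515553480606005300535757480002570248574857000606511301020258010258590102020806065506554857000252024812124800,
    655064857485714121205,
    475547570606571257124848⟩,
   ⟨[11, 15, 1, 0, 1, 0], 40,
    47474747615300535154514855480606615300535448480002520248574857615554514801520248380539590105025855060606544857610205024810054800,
    4701064805,
    571257121248⟩,
   ⟨[27, 7, 1, 0, 1, 0], 40,
    47474747535355550653555506630606535553555757616102570261544848000655535502025761010202480202080806066306614814000108020802121200,
    4814121210,
    606⟩,
   ⟨[4, 11, 5, 1, 0, 1, 0], 81,
    4706475147514747000653656161534747064751475147050606475561494706490149014901495707574848074800610101010101015105074307430743535506064951495149590106010201020044060659055905590501060101010153440601530161010657476248624862616301010101010107054712636357636363,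
    60744020750,
    0⟩,
   ⟨[82, 60, 19, 5, 1, 0, 1, 0], 105,
    47474702476002024701020151010201470260054702010247026002510201014751470247024702010202010101070147026012020101020102020101010601510164014701021051020201640102010101600107010152510248020901015902010201470247520103020101526352020160015901024801024802010148524747470247600202470211016301020102470252025101024710635264080163470263020709634801020201630252484752644863480148010202486401484847016401010102085102090148010201020102010201015251014852480101480101640159016448015202010101524807010601594848480152484848484848,
    0,
    0⟩,
   ⟨[1, 1, 0, 1, 0], 13,
    4747004747094706495100535111535549510053511153550606000006130000,
    4753076701076157146357121063571212146312121205,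
    57126768⟩,
   ⟨[7, 1, 0, 1, 0], 18,
    4747535553550606717157615761720006710158015801080606606560651200,
    721272,
    0⟩,
   ⟨[11, 5, 1, 0, 1, 0], 40,
    47474747677361710651517106736173677371717248480001020272737373730651517101020272065959590101015606737173737373730102027272634863,
    48,
    0⟩,
   ⟨[41, 19, 5, 1, 0, 1, 0], 53,
    4774477171747401477147717173517271514771017371017172724801727201710174716074740101017659740275720201477101700272730172480172727271744771717374010273027173100272710276750173637273727248017272737101747272724801020102727372487273015973010248727001724801724848,
    0,
    0⟩,
   ⟨[20, 5, 1, 0, 1, 0], 27,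
    47717101477171014771710171757501717171017159755901717177717373734771710101717177717559730101737371757501027373730173737377737339,
    0,
    0⟩,
   ⟨[10, 15, 1, 0, 1, 0], 25,
    47747447747176725102517174017172747171727472724802800272737272485101747101780263790163590101027274017172737272480201027274727248,
    0,
    0⟩,
   ⟨[5, 1, 0, 1, 0], 13,
    4747717171717373717107750182737371710182795901737173737301738163,
    0,
    0⟩,
   ⟨[15, 1, 0, 1, 0], 10,
    4747717171717306717181638163737371718163816373737306737373737200,
    72,
    0⟩,
   ⟨[1, 0, 1, 0], 5,
    47717106718383737183837306737385,
    0,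
    0⟩]

theorem checkSeeds_seeds : checkSeeds memberCodes seeds = true := by
  decide +kernel

open SimpleGraph

section Members

variable {V : Type*}

/-- The adjacency of a graph given by a list of edges. -/
def edgeB {n : ℕ} (E : List (Fin n × Fin n)) (u v : Fin n) : Bool :=
  decide (u ≠ v ∧ ((u, v) ∈ E ∨ (v, u) ∈ E))

theorem adjB_ofEdges {n : ℕ} (E : List (Fin n × Fin n)) : adjB (ofEdges E) = edgeB E := by
  funext u v
  rw [Bool.eq_iff_iff]
  simp [ofEdges, edgeB]

/-- The code of a graph with vertices `0, …, n - 1`. -/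
noncomputable def codeOf (F : FinGraph) : List (List Bool) :=
  code (adjB F.2) (List.finRange F.1)

theorem codeOf_ofEdges {n : ℕ} (E : List (Fin n × Fin n)) :
    codeOf ⟨n, ofEdges E⟩ = code (edgeB E) (List.finRange n) := by
  rw [← adjB_ofEdges]
  rfl

theorem adj_eq_of_code_eq {a b : V → V → Bool} (ha : ∀ u v, a u v = a v u)
    (hb : ∀ u v, b u v = b v u) {vs : List V} (h : code a vs = code b vs) :
    ∀ u ∈ vs, ∀ v ∈ vs, u ≠ v → a u v = b u v := by
  induction vs with
  | nil => simp
  | cons w vs ih =>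
    rw [code, code, List.cons.injEq, List.map_inj_left] at h
    intro u hu v hv huv
    rcases List.mem_cons.1 hu with rfl | hu'
    · exact h.1 v ((List.mem_cons.1 hv).resolve_left huv.symm)
    rcases List.mem_cons.1 hv with rfl | hv'
    · rw [ha, hb]
      exact h.1 u hu'
    · exact ih h.2 u hu' v hv' huv

theorem isIndContained_of_contains {G : SimpleGraph V} {F : FinGraph}
    (h : Contains G (codeOf F)) : F.2 ⊴ G := by
  obtain ⟨n, F⟩ := F
  obtain ⟨ws, hn, hw⟩ := h
  obtain rfl : n = ws.length := by
    rw [← length_code (adjB G) ws, hw, codeOf, length_code, List.length_finRange]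
  have hadj : code (fun i j => adjB G (ws.get i) (ws.get j)) (List.finRange _) =
      code (adjB F) (List.finRange _) := by
    rw [← code_map, List.map_get_finRange, hw]
    rfl
  refine ⟨⟨⟨ws.get, List.nodup_iff_injective_get.1 hn⟩, fun {i j} => ?_⟩⟩
  by_cases hij : i = j
  · subst hij; simp
  · rw [← adjB_eq_true (G := F), ← adj_eq_of_code_eq (fun _ _ => adjB_comm _ _ _)
      (adjB_comm F) hadj i (List.mem_finRange i) j (List.mem_finRange j) hij]
    exact adjB_eq_true.symm

theorem isIndContained_compl_of_contains {G : SimpleGraph V} {F : FinGraph}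
    (h : Contains Gᶜ (codeOf F)) : F.2ᶜ ⊴ G := by
  simpa using (isIndContained_of_contains h).compl

theorem map_eq_of_forall₂ {α β : Type*} {f : α → β} {l : List α} {l' : List β}
    (h : List.Forall₂ (fun a b => f a = b) l l') : l.map f = l' := by
  induction h with
  | nil => rfl
  | cons h _ ih => rw [List.map_cons, h, ih]

theorem map_codeOf_members :
    (selfComplementaryMembers ++ pairedMembers).map codeOf = memberCodes := by
  refine map_eq_of_forall₂ ?_
  rw [memberCodes, List.forall₂_map_right_iff]
  repeat' first
    | exact .nil
    | refine .cons ((codeOf_ofEdges _).trans (by decide +kernel)) ?_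

/-- The colourings of the graph with a given code. -/
def colorings : List (List Bool) → List (List Bool)
  | [] => [[]]
  | p :: f => (colorings f).flatMap fun c => [true, false].flatMap fun b =>
      if okVertex b c f p then [b :: c] else []

theorem mem_colorings_iff {f : List (List Bool)} {c : List Bool} :
    c ∈ colorings f ↔ c.length = f.length ∧ okColoring c f = true := by
  induction f generalizing c with
  | nil => cases c <;> simp [colorings, okColoring]
  | cons p f ih =>
    cases c with
    | nil => simp [colorings]
    | cons b c =>
      have h : (b :: c) ∈ colorings (p :: f) ↔ c ∈ colorings f ∧ okVertex b c f p = true := by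
        simp only [colorings, List.mem_flatMap]
        constructor
        · rintro ⟨c', hc, b', -, h⟩
          split_ifs at h with h'
          · simp only [List.mem_singleton, List.cons.injEq] at h
            obtain ⟨rfl, rfl⟩ := h
            exact ⟨hc, h'⟩
          · cases h
        · rintro ⟨hc, h⟩
          exact ⟨c, hc, b, mem_true_false b, by simp [h]⟩
      rw [h, ih, okColoring, Bool.and_eq_true]
      rw [List.length_cons, List.length_cons, Nat.succ_inj]
      tauto

theorem not_hasColoring {G : SimpleGraph V} {vs : List V} (hvs : vs.Nodup)
    (h : colorings (code (adjB G) vs) = []) : ¬ HasColoring G := by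
  rintro ⟨χ, hχ⟩
  have : vs.map χ ∈ colorings (code (adjB G) vs) :=
    mem_colorings_iff.2 ⟨by simp, (okColoring_iff hvs).2 fun x _ y _ z _ => hχ x y z⟩
  rw [h] at this
  cases this

theorem hasColoring_induce {G : SimpleGraph V} {vs : List V} (hvs : vs.Nodup)
    (h : colorings (code (adjB G) vs) ≠ []) {s : Set V} (hs : ∀ v ∈ s, v ∈ vs) :
    HasColoring (G.induce s) := by
  obtain ⟨c, hc⟩ := List.exists_mem_of_ne_nil _ h
  rw [mem_colorings_iff, length_code] at hc
  obtain ⟨χ, rfl⟩ := exists_map_eq hvs hc.1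
  have := (okColoring_iff hvs).1 hc.2
  refine ⟨fun v => χ v, fun x y z hxy hxz hyz => ?_⟩
  have h := this x (hs x x.2) y (hs y y.2) z (hs z z.2) (by simpa [Subtype.ext_iff] using hxy)
    (by simpa [Subtype.ext_iff] using hxz) (by simpa [Subtype.ext_iff] using hyz)
  exact h

/-- The graph has no colouring, but all its vertex-deleted subgraphs have one. -/
def IsCritical (G : SimpleGraph V) : Prop :=
  ¬ HasColoring G ∧ ∀ v, HasColoring (G.induce {v}ᶜ)

/-- The verification that the graph with given edges is critical. -/
def checkCritical {n : ℕ} (E : List (Fin n × Fin n)) : Bool :=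
  (colorings (code (edgeB E) (List.finRange n))).isEmpty && (List.finRange n).all fun v =>
    !(colorings (code (edgeB E) ((List.finRange n).filter fun w => decide (w ≠ v)))).isEmpty

theorem isCritical_ofEdges {n : ℕ} {E : List (Fin n × Fin n)} (h : checkCritical E = true) :
    IsCritical (ofEdges E) := by
  rw [checkCritical, Bool.and_eq_true, List.isEmpty_iff, List.all_eq_true] at h
  rw [← adjB_ofEdges] at h
  refine ⟨not_hasColoring (List.nodup_finRange n) h.1, fun v => ?_⟩
  have := h.2 v (List.mem_finRange v)
  rw [Bool.not_eq_true', List.isEmpty_eq_false_iff] at this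
  exact hasColoring_induce ((List.nodup_finRange n).filter _) this (by simp)

theorem induce_compl' (G : SimpleGraph V) (s : Set V) : Gᶜ.induce s = (G.induce s)ᶜ := by
  ext x y
  simp [Subtype.ext_iff]

theorem IsCritical.compl {G : SimpleGraph V} (h : IsCritical G) : IsCritical Gᶜ :=
  ⟨fun h' => h.1 (hasColoring_compl_iff.1 h'), fun v => by
    rw [induce_compl']
    exact (h.2 v).compl⟩

theorem isCritical_of_mem_members :
    ∀ F ∈ selfComplementaryMembers ++ pairedMembers, IsCritical F.2 := by
  simp only [selfComplementaryMembers, pairedMembers, List.cons_append, List.nil_append,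
    List.forall_mem_cons]
  refine ⟨?_, ?_, ?_, ?_, ?_, ?_, ?_, ?_, ?_, ?_, ?_, ?_, ?_, ?_, ?_, ?_, ?_, ?_, ?_, ?_, ?_, ?_,
    ?_, by simp⟩ <;> exact isCritical_ofEdges (by decide +kernel)

theorem isCritical_of_mem_family {F : FinGraph} (hF : F ∈ family) : IsCritical F.2 := by
  rw [family, List.mem_append] at hF
  rcases hF with hF | hF
  · exact isCritical_of_mem_members F hF
  · obtain ⟨F, hF', rfl⟩ := List.mem_map.1 hF
    exact (isCritical_of_mem_members F (List.mem_append_right _ hF')).compl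

/-- A numerical invariant of graphs. -/
def degreeInvariant {n : ℕ} (adj : Fin n → Fin n → Bool) : ℕ :=
  ∑ v, (1 + ∑ w, cond (adj v w) (∑ u, cond (adj w u) 1 0) 0) ^ 2

/-- A numerical invariant of graphs. -/
noncomputable def inv (F : FinGraph) : ℕ := degreeInvariant (adjB F.2)

theorem inv_ofEdges {n : ℕ} (E : List (Fin n × Fin n)) :
    inv ⟨n, ofEdges E⟩ = degreeInvariant (edgeB E) := by
  rw [← adjB_ofEdges]
  rfl

theorem inv_compl_ofEdges {n : ℕ} (E : List (Fin n × Fin n)) :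
    inv ⟨n, (ofEdges E)ᶜ⟩ = degreeInvariant fun u v => decide (u ≠ v) && !edgeB E u v := by
  rw [← adjB_ofEdges, inv]
  congr
  funext u v
  by_cases h : u = v
  · simp [h]
  · simp [h, adjB_compl]

theorem inv_eq_of_iso {F F' : FinGraph} (e : F.2 ≃g F'.2) : inv F = inv F' := by
  obtain ⟨n, F⟩ := F
  obtain ⟨m, F'⟩ := F'
  obtain rfl : n = m := by simpa using Fintype.card_congr e.toEquiv
  have hadj : ∀ u v, adjB F u v = adjB F' (e u) (e v) := fun u v => by
    rw [Bool.eq_iff_iff, adjB_eq_true, adjB_eq_true]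
    exact e.map_adj_iff.symm
  simp only [inv, degreeInvariant, hadj]
  refine Fintype.sum_equiv e.toEquiv _ _ fun v => ?_
  congr 2
  refine Fintype.sum_equiv e.toEquiv _ _ fun w => ?_
  congr 1
  exact Fintype.sum_equiv e.toEquiv _ _ fun u => rfl

theorem map_inv_selfComplementaryMembers : selfComplementaryMembers.map inv = [125, 2601] := by
  refine map_eq_of_forall₂ ?_
  repeat' first
    | exact .nil
    | refine .cons ((inv_ofEdges _).trans (by decide +kernel)) ?_

theorem map_inv_pairedMembers :
    pairedMembers.map inv =
      [245, 202, 108, 180, 302, 36, 58, 156, 232, 278, 392, 175, 605, 831, 1115, 151, 709, 1375, 767, 571, 3519] := by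
  refine map_eq_of_forall₂ ?_
  repeat' first
    | exact .nil
    | refine .cons ((inv_ofEdges _).trans (by decide +kernel)) ?_

theorem map_inv_compl_pairedMembers :
    pairedMembers.map (fun F => inv ⟨F.1, F.2ᶜ⟩) =
      [83, 724, 914, 650, 480, 1822, 1300, 1034, 774, 808, 654, 2023, 1379, 1089, 923, 2791, 979, 601, 1031, 1425, 4579] := by
  refine map_eq_of_forall₂ ?_
  repeat' first
    | exact .nil
    | refine .cons ((inv_compl_ofEdges _).trans (by decide +kernel)) ?_

theorem nodup_map_inv_family : (family.map inv).Nodup := by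
  rw [family, List.map_append, List.map_append, List.map_map, map_inv_selfComplementaryMembers,
    map_inv_pairedMembers, Function.comp_def, map_inv_compl_pairedMembers]
  decide +kernel

end Members

open SimpleGraph

section Main

variable {V : Type*}

theorem embeds_complCode :
    ∀ f ∈ (memberCodes.take 2), embeds f (complCode f) = true := by
  decide +kernel

theorem isCode_of_mem_memberCodes : ∀ f ∈ memberCodes, IsCode f := by
  intro f hf
  obtain ⟨ns, -, rfl⟩ := List.mem_map.1 hf
  exact isCode_decode ns

theorem isIndContained_compl_self {F : FinGraph} (hF : F ∈ selfComplementaryMembers) :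
    F.2 ⊴ F.2ᶜ := by
  have h1 : codeOf F ∈ memberCodes.take 2 := by
    rw [← map_codeOf_members, ← List.map_take]
    exact List.mem_map_of_mem hF
  have h := embeds_complCode _ h1
  nth_rw 2 [codeOf] at h
  rw [complCode_code _ (List.nodup_finRange _)] at h
  exact isIndContained_of_contains (contains_of_embeds _ (List.nodup_finRange _)
    (isCode_of_mem_memberCodes _ (List.mem_of_mem_take h1)) h)

theorem free_memberCodes {G : SimpleGraph V} (hG : ∀ F ∈ family, ¬ F.2 ⊴ G) :
    Free memberCodes G := by
  intro f hf
  rw [← map_codeOf_members] at hf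
  obtain ⟨F, hF, rfl⟩ := List.mem_map.1 hf
  refine ⟨fun h => hG F (List.mem_append_left _ hF) (isIndContained_of_contains h), fun h => ?_⟩
  have h := isIndContained_compl_of_contains h
  rcases List.mem_append.1 hF with hF' | hF'
  · exact hG F (List.mem_append_left _ hF) ((isIndContained_compl_self hF').trans h)
  · exact hG ⟨F.1, F.2ᶜ⟩ (List.mem_append_right _ (List.mem_map_of_mem hF')) h

theorem hasColoring_of_free [Finite V] {G : SimpleGraph V} (hG : Free memberCodes G) :
    HasColoring G := by
  by_contra hχ
  have h := free_of_checkSeeds isCode_of_mem_memberCodes hG hχ checkSeeds_seeds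
  have hK : [[true, false, false], [false, false], [true], []] ∈
      memberCodes ++ seeds.map Seed.graph := by decide +kernel
  have hC : [[true, false, false, true], [true, false, false], [true, false], [true], []] ∈
      memberCodes ++ seeds.map Seed.graph := by decide +kernel
  obtain ⟨K, hK, hI⟩ := exists_isClique_isIndepSet G
    (fun a b c d hab hcd hac had hbc hbd hac' had' hbc' hbd' => (h _ hK).1
      ⟨[a, b, c, d], by simp [hab.ne, hcd.ne, *], by simp [code, *]⟩)
    (fun a b c d hab hbc hcd hda hac hbd hac' hbd' => (h _ hK).2
      ⟨[a, c, b, d], by simp [hab.ne, hcd.ne, hda.ne', hbc.ne', *],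
        by simp [code, hda.symm, hbc.symm, *]⟩)
    (fun a b c d e hab hbc hcd hde hea hac had hbd hbe hce hac' had' hbd' hbe' hce' =>
      (h _ hC).1 ⟨[a, b, c, d, e], by simp [hab.ne, hbc.ne, hcd.ne, hde.ne, hea.ne', *],
        by simp [code, hea.symm, *]⟩)
  exact hχ (hasColoring_of_isClique_isIndepSet hK hI)

theorem hasColoring_iff [Finite V] {G : SimpleGraph V} :
    HasColoring G ↔ ∀ F ∈ family, ¬ F.2 ⊴ G :=
  ⟨fun h _ hF hFG => (isCritical_of_mem_family hF).1 (h.of_isIndContained hFG),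
    fun h => hasColoring_of_free (free_memberCodes h)⟩

theorem IsCritical.hasColoring_induce_of_iso {W : Type*} {F : SimpleGraph W} (hF : IsCritical F)
    {G : SimpleGraph V} (e : G ≃g F) {s : Set V} (hs : s ≠ Set.univ) :
    HasColoring (G.induce s) := by
  obtain ⟨v, hv⟩ := (Set.ne_univ_iff_exists_notMem s).1 hs
  have hsv : ∀ w : s, e w ∈ ({e v}ᶜ : Set W) := by
    rintro ⟨w, hw⟩ h
    exact hv (e.injective h ▸ hw)
  refine (hF.2 (e v)).of_isIndContained
    ⟨⟨⟨fun w => ⟨e w, hsv w⟩, fun w w' h => ?_⟩, fun {w w'} => e.map_adj_iff⟩⟩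
  exact Subtype.ext (e.injective (congrArg Subtype.val h))

end Main

end DoubledGraphs

theorem mainTheorem1 :
    (∀ (V : Type u) [Finite V] (G : SimpleGraph V),
      DoubledGraphs.IsDoubled G ↔
        ∀ F ∈ DoubledGraphs.family, ¬ SimpleGraph.IsIndContained F.2 G) ∧
    (∀ (V : Type u) [Finite V] (G : SimpleGraph V),
      DoubledGraphs.IsMinimalNonDoubled G ↔
        ∃ F ∈ DoubledGraphs.family, Nonempty (G ≃g F.2)) ∧
    DoubledGraphs.family.length = 44 ∧
    DoubledGraphs.family.Pairwise (fun F F' => IsEmpty (F.2 ≃g F'.2)) := by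
  open DoubledGraphs in
  refine ⟨fun V _ G => isDoubled_iff_hasColoring.trans hasColoring_iff, fun V _ G => ?_, rfl, ?_⟩
  · simp only [IsMinimalNonDoubled, isDoubled_iff_hasColoring]
    constructor
    · rintro ⟨hG, hs⟩
      rw [hasColoring_iff] at hG
      push Not at hG
      obtain ⟨F, hF, ⟨φ⟩⟩ := hG
      have hsurj : Function.Surjective φ := by
        rw [← Set.range_eq_univ]
        by_contra hne
        refine (isCritical_of_mem_family hF).1 ((hs _ hne).of_isIndContained ?_)
        exact ⟨⟨⟨Set.rangeFactorization φ, fun x y h => φ.injective (congrArg Subtype.val h)⟩,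
          fun {x y} => φ.map_adj_iff⟩⟩
      exact ⟨F, hF, ⟨(RelIso.ofSurjective φ hsurj).symm⟩⟩
    · rintro ⟨F, hF, ⟨e⟩⟩
      have hc := isCritical_of_mem_family hF
      exact ⟨fun h => hc.1 (h.of_isIndContained ⟨e.symm.toEmbedding⟩),
        fun s hs => hc.hasColoring_induce_of_iso e hs⟩
  · have h := nodup_map_inv_family
    rw [List.Nodup, List.pairwise_map] at h
    exact h.imp fun hne => ⟨fun e => hne (inv_eq_of_iso e)⟩
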